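/- Let $G=(V,D,B)$ be a mixed graph: $V$ is a finite set of nodes, $D\subseteq V\times V$ is the set of directed edges $v\to w$, $B$ is the symmetric set of bidirected edges $v\leftrightarrow w$, and there are no self-loops. Put $\mathrm{pa}(v)=\{w: w\to v\in D\}$ and $\mathrm{sib}(v)=\{w: w\leftrightarrow v\in B\}$. A half-trek from $y$ to $k$ is a path $y\to x_1\to\cdots\to x_m=k$ with $m\ge 0$ (right-hand side $\{y,x_1,\dots,x_m\}$) or a path $y\leftrightarrow x_0\to x_1\to\cdots\to x_m=k$ with $m\ge 0$ (right-hand side $\{x_0,\dots,x_m\}$); its left-hand side is $\{y\}$, and nodes may be repeated. A set $Y\subseteq V$ satisfies the half-trek criterion with respect to $v$ if $|Y|=|\mathrm{pa}(v)|$, $Y\cap(\{v\}\cup\mathrm{sib}(v))=\varnothing$, and there is a set of half-treks whose sources are distinct and form $Y$, whose targets are distinct and form $\mathrm{pa}(v)$, and whose left-hand sides, and also right-hand sides, are pairwise disjoint. The graph $G$ is HTC-infinite-to-one if every family $(Y_v: v\in V)$ of subsets of $V$ contains a set $Y_v$ that fails the half-trek criterion with respect to $v$, or a pair of sets $Y_v,Y_w$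 with $v\in Y_w$ and $w\in Y_v$. Let $G_{\mathrm{flow}}$ be the following network. Its nodes are a source $s$, a sink $t$, a node $L\{v,w\}$ for each unordered pair of distinct nodes $v,w\in V$ with $v\leftrightarrow w\notin B$, and a node $R_v(w)$ for all $v,w\in V$. Its edges are $s\to L\{v,w\}$, $L\{v,w\}\to R_v(w)$ and $L\{v,w\}\to R_w(v)$ for each such pair; $L\{v,w\}\to R_v(u)$ for each such pair, in either order of $v$ and $w$, and each $u$ with $w\leftrightarrow u\in B$; $R_v(w)\to R_v(u)$ for $v\in V$ and $w\to u\in D$; and $R_v(w)\to t$ for $w\in\mathrm{pa}(v)$. All edges and the nodes $s,t$ have capacity $\infty$; all other nodes have capacity $1$. A flow is a function $f\ge 0$ on the edges with values in $\mathbb R$ that is conserved at every node other than $s$ and $t$ and respects the node and edge capacities; its size is $\sum_x f(s,x)$, and the max-flow problem is to find a flow of maximum size. Then $G$ is HTC-infinite-to-one if and only if $G_{\mathrm{flow}}$ has maximum flow size strictly less than $|D|=\sum_{v\in V}|\mathrm{pa}(v)|$. Moreover, the computational complexity of solving this max-flow problem is $\mathcal O(|V|^3(|V|+r)^3)$, where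 $r\le|D|/2$ is the number of reciprocal edge pairs of $G$, that is, of unordered pairs of distinct nodes $v,w$ with $v\to w\in D$ and $w\to v\in D$: there are a fixed program of a unit-cost random access machine (with addition, truncated subtraction, indirect addressing and zero tests on natural numbers) and a constant $C$ such that, for every $G$ with $V\ne\varnothing$ and every numbering of the nodes of $G_{\mathrm{flow}}$, the program, given $G_{\mathrm{flow}}$ by its node capacities and its adjacency matrix with edge capacities, halts with a maximum flow and its size after at most $C\,|V|^3(|V|+r)^3$ steps. -/

import Mathlib

open scoped NNReal ENNReal

universe u

/-! ## Mixed graphs, treks and the half-trek criterion -/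

/-- A mixed graph on the node set `V`: directed edges `v → w` and (symmetric) bidirected
edges `v ↔ w`, both without self-loops. Directed cycles, and several edges of different kinds
between two nodes, are allowed. -/
structure MixedGraph (V : Type u) where
  /-- `dir v w` means `v → w ∈ D`. -/
  dir : V → V → Prop
  /-- `bidir v w` means `v ↔ w ∈ B`. -/
  bidir : V → V → Prop
  dir_irrefl : ∀ v, ¬ dir v v
  bidir_irrefl : ∀ v, ¬ bidir v v
  bidir_symm : ∀ v w, bidir v w → bidir w v

namespace MixedGraph

variable {V : Type u} (G : MixedGraph V)

/-- The set of parents of `v`. -/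
def pa (v : V) : Set V := {w | G.dir w v}

/-- The set of siblings of `v`. -/
def sib (v : V) : Set V := {w | G.bidir w v}

/-- The number `|D|` of directed edges. -/
noncomputable def numDirected : ℕ := {p : V × V | G.dir p.1 p.2}.ncard

/-- The number `r` of reciprocal edge pairs: unordered pairs of distinct nodes `v, w` such that
both `v → w` and `w → v` are edges. -/
noncomputable def numReciprocal : ℕ :=
  {z : Sym2 V | ∃ v w, v ≠ w ∧ G.dir v w ∧ G.dir w v ∧ z = s(v, w)}.ncard

/-- A trek
`vL_l ← ⋯ ← vL_1 ← vL_0 ↔ vR_0 → vR_1 → ⋯ → vR_r` or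
`vL_l ← ⋯ ← vL_1 ← vT → vR_1 → ⋯ → vR_r`,
given by the lists `[vL_0, …, vL_l]`, `[vR_0, …, vR_r]`, with `vL_0 = vR_0 = vT` in the second
case. Nodes may be repeated. -/
@[ext]
structure Trek where
  leftList : List V
  rightList : List V
  left_ne_nil : leftList ≠ []
  right_ne_nil : rightList ≠ []
  left_chain : leftList.IsChain G.dir
  right_chain : rightList.IsChain G.dir
  join : leftList.head left_ne_nil = rightList.head right_ne_nil ∨
    G.bidir (leftList.head left_ne_nil) (rightList.head right_ne_nil)

namespace Trek

variable {G} (π : G.Trek)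

/-- The source of a trek. -/
def source : V := π.leftList.getLast π.left_ne_nil

/-- The target of a trek. -/
def target : V := π.rightList.getLast π.right_ne_nil

/-- The left-hand side `Left(π)`. -/
def left : Set V := {x | x ∈ π.leftList}

/-- The right-hand side `Right(π)`. -/
def right : Set V := {x | x ∈ π.rightList}

/-- A half-trek is a trek with `|Left(π)| = 1`. -/
def IsHalfTrek : Prop := π.left.ncard = 1

end Trek

/-- `T` is a system of treks from `X` to `Y`: the sources are distinct and form `X`, and the
targets are distinct and form `Y`. -/
def IsTrekSystem (T : Set G.Trek) (X Y : Set V) : Prop :=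
  Set.BijOn Trek.source T X ∧ Set.BijOn Trek.target T Y

/-- A set of treks has no sided intersection if the left-hand sides are pairwise disjoint and the
right-hand sides are pairwise disjoint. -/
def NoSidedIntersection (T : Set G.Trek) : Prop :=
  ∀ π ∈ T, ∀ ρ ∈ T, π ≠ ρ → Disjoint π.left ρ.left ∧ Disjoint π.right ρ.right

/-- The set `Y` satisfies the half-trek criterion with respect to the node `v`. -/
def HalfTrekCriterion (v : V) (Y : Set V) : Prop :=
  Y.ncard = (G.pa v).ncard ∧
  Y ∩ ({v} ∪ G.sib v) = ∅ ∧
  ∃ T : Set G.Trek, G.IsTrekSystem T Y (G.pa v) ∧ (∀ π ∈ T, π.IsHalfTrek) ∧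
    G.NoSidedIntersection T

/-- `G` is HTC-infinite-to-one: every family `(Y_v : v ∈ V)` of subsets of `V` contains a set
`Y_v` that fails the half-trek criterion with respect to `v`, or a pair of sets `Y_v, Y_w` with
`v ∈ Y_w` and `w ∈ Y_v`. -/
def HTCInfiniteToOne : Prop :=
  ∀ Y : V → Set V,
    (∃ v, ¬ G.HalfTrekCriterion v (Y v)) ∨ (∃ v w, v ∈ Y w ∧ w ∈ Y v)

end MixedGraph

/-! ## Flow networks and the max-flow problem -/

/-- A directed graph with a source, a sink, node capacities and edge capacities
(nonnegative reals or `∞`). -/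
structure FlowNetwork (N : Type u) where
  edge : N → N → Prop
  source : N
  sink : N
  nodeCap : N → ℝ≥0∞
  /-- Only the values on edges matter. -/
  edgeCap : N → N → ℝ≥0∞

namespace FlowNetwork

variable {N : Type u} [Fintype N] (F : FlowNetwork N)

/-- A flow: a nonnegative real function on the edges (extended by `0` to all pairs of nodes) that
is conserved and obeys the node capacity at every node other than source and sink, and obeys the
edge capacities. -/
def IsFlow (f : N → N → ℝ≥0) : Prop :=
  (∀ x y, ¬ F.edge x y → f x y = 0) ∧
  (∀ x, x ≠ F.source → x ≠ F.sink →
    ∑ y, f y x = ∑ y, f x y ∧ ((∑ y, f x y : ℝ≥0) : ℝ≥0∞) ≤ F.nodeCap x) ∧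
  (∀ x y, F.edge x y → (f x y : ℝ≥0∞) ≤ F.edgeCap x y)

/-- The size of a flow: the total amount that leaves the source. (The networks considered here
have no edge into the source.) -/
def size (f : N → N → ℝ≥0) : ℝ≥0 := ∑ y, f F.source y

/-- A solution of the max-flow problem: a flow of maximum size among all real-valued flows. -/
def IsMaxFlow (f : N → N → ℝ≥0) : Prop :=
  F.IsFlow f ∧ ∀ g, F.IsFlow g → F.size g ≤ F.size f

end FlowNetwork

/-! ## The network `G_flow` -/

namespace MixedGraph

variable {V : Type u} (G : MixedGraph V)

/-- Unordered pairs `{v, w}` of distinct nodes that are not siblings. -/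
def NonSiblingPair : Type u :=
  {z : Sym2 V // ∃ v w, v ≠ w ∧ ¬ G.bidir v w ∧ z = s(v, w)}

/-- The nodes of `G_flow`: `s`, `t`, the left-hand copies `L{v, w}` for all non-sibling pairs
`{v, w}`, and the right-hand copies `R_v(w)`, written `right v w`, for all `v, w`. -/
inductive FlowNode : Type u
  | source
  | sink
  | left (p : G.NonSiblingPair)
  | right (v w : V)

instance [Finite V] : Finite G.FlowNode := by
  have : Finite (Sym2 V) := Quot.finite _
  have : Finite G.NonSiblingPair := Subtype.finite
  let φ : G.FlowNode → Bool ⊕ G.NonSiblingPair ⊕ V × V := fun x =>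
    match x with
    | .source => .inl true
    | .sink => .inl false
    | .left p => .inr (.inl p)
    | .right v w => .inr (.inr (v, w))
  refine Finite.of_injective φ ?_
  intro x y h
  cases x <;> cases y <;> simp_all [φ]

noncomputable instance [Fintype V] : Fintype G.FlowNode := Fintype.ofFinite _

/-- The edges of `G_flow`. The pair `{v, w}` is unordered, so that `L{v, w}` has edges into the
copies `R_v` and `R_w`. -/
inductive FlowEdge : G.FlowNode → G.FlowNode → Prop
  /-- `s → L{v, w}` -/
  | source_left (p : G.NonSiblingPair) : FlowEdge .source (.left p)
  /-- `L{v, w} → R_v(w)` -/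
  | left_right (p : G.NonSiblingPair) (v w : V) (h : p.1 = s(v, w)) :
      FlowEdge (.left p) (.right v w)
  /-- `L{v, w} → R_v(u)` for `w ↔ u` -/
  | left_right_sib (p : G.NonSiblingPair) (v w x : V) (h : p.1 = s(v, w)) (hx : G.bidir w x) :
      FlowEdge (.left p) (.right v x)
  /-- `R_v(w) → R_v(u)` for `w → u` -/
  | right_right (v w x : V) (h : G.dir w x) : FlowEdge (.right v w) (.right v x)
  /-- `R_v(w) → t` for `w ∈ pa(v)` -/
  | right_sink (v w : V) (h : w ∈ G.pa v) : FlowEdge (.right v w) .sink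

/-- The flow network `G_flow`: all edges, the source and the sink have capacity `∞`, and all other
nodes have capacity `1`. -/
noncomputable def flowNetwork : FlowNetwork G.FlowNode where
  edge := G.FlowEdge
  source := .source
  sink := .sink
  nodeCap x := match x with
    | .source => ⊤
    | .sink => ⊤
    | .left _ => 1
    | .right _ _ => 1
  edgeCap _ _ := ⊤

end MixedGraph

/-! ## A random access machine with unit costs -/

/-- The state of the machine: registers and an indirectly addressed memory, holding natural
numbers. -/
structure RAMState where
  reg : ℕ → ℕ
  mem : ℕ → ℕ

/-- Programs of a random access machine, with structured control flow. A program mentions only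
finitely many registers; the only arithmetic is addition and (truncated) subtraction. -/
inductive RAMProgram : Type
  /-- do nothing -/
  | skip
  /-- `R_i := c` -/
  | const (i c : ℕ)
  /-- `R_i := R_j + R_k` -/
  | add (i j k : ℕ)
  /-- `R_i := R_j - R_k` (`0` if `R_j < R_k`) -/
  | sub (i j k : ℕ)
  /-- `R_i := M[R_j]` -/
  | load (i j : ℕ)
  /-- `M[R_i] := R_j` -/
  | store (i j : ℕ)
  /-- sequential composition -/
  | seq (P Q : RAMProgram)
  /-- `if R_i ≠ 0 then P else Q` -/
  | ite (i : ℕ) (P Q : RAMProgram)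
  /-- `while R_i ≠ 0 do P` -/
  | loop (i : ℕ) (P : RAMProgram)

namespace RAMState

/-- Overwrite a register. -/
def setReg (σ : RAMState) (i x : ℕ) : RAMState := ⟨Function.update σ.reg i x, σ.mem⟩

/-- Overwrite a memory cell. -/
def setMem (σ : RAMState) (a x : ℕ) : RAMState := ⟨σ.reg, Function.update σ.mem a x⟩

end RAMState

/-- `RAMExec P σ σ' k`: started in the state `σ`, the program `P` halts in the state `σ'` after
exactly `k` steps. Every instruction and every evaluation of a test costs one step. The execution
is deterministic: at most one pair `σ', k` is possible for given `P, σ`. -/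
inductive RAMExec : RAMProgram → RAMState → RAMState → ℕ → Prop
  | skip (σ : RAMState) : RAMExec .skip σ σ 1
  | const (σ : RAMState) (i c : ℕ) : RAMExec (.const i c) σ (σ.setReg i c) 1
  | add (σ : RAMState) (i j k : ℕ) :
      RAMExec (.add i j k) σ (σ.setReg i (σ.reg j + σ.reg k)) 1
  | sub (σ : RAMState) (i j k : ℕ) :
      RAMExec (.sub i j k) σ (σ.setReg i (σ.reg j - σ.reg k)) 1
  | load (σ : RAMState) (i j : ℕ) :
      RAMExec (.load i j) σ (σ.setReg i (σ.mem (σ.reg j))) 1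
  | store (σ : RAMState) (i j : ℕ) :
      RAMExec (.store i j) σ (σ.setMem (σ.reg i) (σ.reg j)) 1
  | seq {P Q : RAMProgram} {σ σ' σ'' : RAMState} {k l : ℕ} (hP : RAMExec P σ σ' k)
      (hQ : RAMExec Q σ' σ'' l) : RAMExec (.seq P Q) σ σ'' (k + l)
  | ite_true {i : ℕ} {P Q : RAMProgram} {σ σ' : RAMState} {k : ℕ} (h : σ.reg i ≠ 0)
      (hP : RAMExec P σ σ' k) : RAMExec (.ite i P Q) σ σ' (k + 1)
  | ite_false {i : ℕ} {P Q : RAMProgram} {σ σ' : RAMState} {k : ℕ} (h : σ.reg i = 0)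
      (hQ : RAMExec Q σ σ' k) : RAMExec (.ite i P Q) σ σ' (k + 1)
  | loop_true {i : ℕ} {P : RAMProgram} {σ σ' σ'' : RAMState} {k l : ℕ} (h : σ.reg i ≠ 0)
      (hP : RAMExec P σ σ' k) (hL : RAMExec (.loop i P) σ' σ'' l) :
      RAMExec (.loop i P) σ σ'' (k + l + 1)
  | loop_false {i : ℕ} {P : RAMProgram} {σ : RAMState} (h : σ.reg i = 0) :
      RAMExec (.loop i P) σ σ 1

/-! ## Max-flow instances as inputs of the machine -/

namespace FlowNetwork

/-- The code of a capacity that is a natural number or `∞`: `0` for `∞`, and `a + 1` for the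
natural number `a`. -/
noncomputable def capCode (c : ℝ≥0∞) : ℕ := if c = ⊤ then 0 else ⌊c.toNNReal⌋₊ + 1

variable {N : Type u} (F : FlowNetwork N)

open Classical in
/-- The initial state of the machine for the max-flow problem on `F`, where `F` has natural or
infinite capacities and its `n` nodes are numbered by `0, …, n - 1`:
the registers `R_0, R_1, R_2` hold `n`, the source and the sink;
the memory cell `i < n` holds the code of the capacity of the node `i`;
the memory cell `n + n * i + j`, for `i, j < n`, holds `0` if there is no edge from `i` to `j`, and
one plus the code of its capacity if there is one;
all other registers and memory cells hold `0`. -/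
noncomputable def input {n : ℕ} (e : N ≃ Fin n) : RAMState where
  reg k := if k = 0 then n else if k = 1 then e F.source else if k = 2 then e F.sink else 0
  mem a :=
    if h : a < n then capCode (F.nodeCap (e.symm ⟨a, h⟩))
    else if h : a - n < n * n then
      if F.edge (e.symm (finProdFinEquiv.symm ⟨a - n, h⟩).1)
          (e.symm (finProdFinEquiv.symm ⟨a - n, h⟩).2) then
        capCode (F.edgeCap (e.symm (finProdFinEquiv.symm ⟨a - n, h⟩).1)
          (e.symm (finProdFinEquiv.symm ⟨a - n, h⟩).2)) + 1
      else 0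
    else 0

/-- The state `σ` of the machine presents a solution of the max-flow problem on `F`, with nodes
numbered by `0, …, n - 1`: there is a maximum flow `f` whose size is in the register `R_0` and
whose value on the pair `(i, j)` is in the memory cell `n + n * n + n * i + j`. -/
def IsOutput [Fintype N] {n : ℕ} (e : N ≃ Fin n) (σ : RAMState) : Prop :=
  ∃ f : N → N → ℝ≥0, F.IsMaxFlow f ∧ (σ.reg 0 : ℝ≥0) = F.size f ∧
    ∀ i j : Fin n, (σ.mem (n + n * n + n * i + j) : ℝ≥0) = f (e.symm i) (e.symm j)

end FlowNetwork

/-! Inner nodes have capacity one, so the max-flow problem asks for vertex-disjoint paths from `s`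
to `t`. Such paths are stored as a predecessor function `p` with `p a = a` at unused nodes. Then `p`
is injective off the fibre over `s`, and the nodes outside its range are the last inner nodes of the
paths.

Splitting every node into an in-copy and an out-copy makes `p` a matching, and one searches for
alternating paths: from a reached node `a` pass to `p a`, and from there along any edge. If some `p
a` has an edge to `t`, reassigning predecessors along the search tree gives one more path. Otherwise
the reached set `W` is a barrier: `X = p(W)` and `K = W \ p(W)` form a vertex cut, and counting
fibres of `p` shows that |K| is the number of paths (`Linkage.exists_isCut`). No real flow exceeds
|K| (`IsCut.size_le`), so the 0-1 flow along the paths is maximum.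

The algorithm is an explicit program, verified in a weakest-precondition calculus (`wp_maxFlow`).
With n network nodes a search costs O(n²), an augmentation costs O(n), and there are at most n
augmentations. As n = O(|V|²), the total is O(|V|⁶), and |V|⁶ ≤ |V|³(|V|+r)³. The same result
supplies the linkage and barrier needed for the equivalence.

If a family `Y` satisfies all criteria without mutual membership, each edge w → v has a half-trek,
which traces a walk from `s` to `t` through the copy R_v. A cut K meets all these walks, and no node
of K serves two of them: a common R_v(z) contradicts disjoint right-hand sides, a common L{v,w}
contradicts distinct sources or the absence of mutual membership. So |D| ≤ |K|
(`numDirected_le_card_of_isCut`). Conversely, in a linkage with |D| paths every R_v(w) with w ∈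
pa(v) ends a path; read backwards, these paths are half-treks, and their disjointness yields `Y`
(`exists_family_of_linkage`). -/

/-! ## Weakest preconditions for the random access machine -/

namespace RAMProgram

/-- `P` halts when started in `σ`, in a state and after a number of steps that satisfy `Q`. -/
def wp (P : RAMProgram) (Q : RAMState → ℕ → Prop) (σ : RAMState) : Prop :=
  ∃ σ' k, RAMExec P σ σ' k ∧ Q σ' k

/-- Sequential composition of a list of programs. -/
def block : List RAMProgram → RAMProgram
  | [] => .skip
  | P :: l => .seq P (block l)

variable {Q Q' : RAMState → ℕ → Prop} {σ : RAMState} {r m : ℕ → ℕ}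

theorem wp_mono {P : RAMProgram} (h : wp P Q σ) (hQ : ∀ σ' k, Q σ' k → Q' σ' k) : wp P Q' σ := by
  obtain ⟨σ', k, h1, h2⟩ := h
  exact ⟨σ', k, h1, hQ _ _ h2⟩

theorem wp_skip : wp .skip Q σ ↔ Q σ 1 :=
  ⟨fun ⟨_, _, h, hQ⟩ => by cases h; exact hQ, fun h => ⟨_, _, .skip _, h⟩⟩

/-- The rules for single instructions are equivalences on an explicit pair `⟨r, m⟩`, so that `simp
only` can execute straight-line code symbolically. -/
theorem wp_const {i c : ℕ} : wp (.const i c) Q ⟨r, m⟩ ↔ Q ⟨Function.update r i c, m⟩ 1 :=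
  ⟨fun ⟨_, _, h, hQ⟩ => by cases h; exact hQ, fun h => ⟨_, _, .const _ _ _, h⟩⟩

theorem wp_add {i j k : ℕ} :
    wp (.add i j k) Q ⟨r, m⟩ ↔ Q ⟨Function.update r i (r j + r k), m⟩ 1 :=
  ⟨fun ⟨_, _, h, hQ⟩ => by cases h; exact hQ, fun h => ⟨_, _, .add _ _ _ _, h⟩⟩

theorem wp_sub {i j k : ℕ} :
    wp (.sub i j k) Q ⟨r, m⟩ ↔ Q ⟨Function.update r i (r j - r k), m⟩ 1 :=
  ⟨fun ⟨_, _, h, hQ⟩ => by cases h; exact hQ, fun h => ⟨_, _, .sub _ _ _ _, h⟩⟩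

theorem wp_load {i j : ℕ} :
    wp (.load i j) Q ⟨r, m⟩ ↔ Q ⟨Function.update r i (m (r j)), m⟩ 1 :=
  ⟨fun ⟨_, _, h, hQ⟩ => by cases h; exact hQ, fun h => ⟨_, _, .load _ _ _, h⟩⟩

theorem wp_store {i j : ℕ} :
    wp (.store i j) Q ⟨r, m⟩ ↔ Q ⟨r, Function.update m (r i) (r j)⟩ 1 :=
  ⟨fun ⟨_, _, h, hQ⟩ => by cases h; exact hQ, fun h => ⟨_, _, .store _ _ _, h⟩⟩

theorem wp_seq {P R : RAMProgram} :
    wp (.seq P R) Q σ ↔ wp P (fun σ' k => wp R (fun σ'' l => Q σ'' (k + l)) σ') σ := by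
  constructor
  · rintro ⟨_, _, h, hQ⟩
    cases h with
    | seq hP hR => exact ⟨_, _, hP, _, _, hR, hQ⟩
  · rintro ⟨_, _, hP, _, _, hR, hQ⟩
    exact ⟨_, _, .seq hP hR, hQ⟩

theorem wp_ite {i : ℕ} {P R : RAMProgram} :
    wp (.ite i P R) Q ⟨r, m⟩ ↔
      (r i ≠ 0 → wp P (fun σ' k => Q σ' (k + 1)) ⟨r, m⟩) ∧
      (r i = 0 → wp R (fun σ' k => Q σ' (k + 1)) ⟨r, m⟩) := by
  constructor
  · rintro ⟨_, _, h, hQ⟩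
    cases h with
    | ite_true h hP => exact ⟨fun _ => ⟨_, _, hP, hQ⟩, fun h' => absurd h' h⟩
    | ite_false h hP => exact ⟨fun h' => absurd h h', fun _ => ⟨_, _, hP, hQ⟩⟩
  · rintro ⟨h1, h2⟩
    by_cases h : r i = 0
    · obtain ⟨_, _, hP, hQ⟩ := h2 h
      exact ⟨_, _, .ite_false h hP, hQ⟩
    · obtain ⟨_, _, hP, hQ⟩ := h1 h
      exact ⟨_, _, .ite_true h hP, hQ⟩

theorem wp_block_nil : wp (block []) Q σ ↔ Q σ 1 := wp_skip

theorem wp_block_cons {P : RAMProgram} {l : List RAMProgram} :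
    wp (block (P :: l)) Q σ ↔
      wp P (fun σ' k => wp (block l) (fun σ'' l => Q σ'' (k + l)) σ') σ := wp_seq

/-- A loop with invariant `I` whose index decreases in every round, each round costing at most
`c` steps. -/
theorem wp_loop {d : ℕ} {P : RAMProgram} (I : ℕ → (ℕ → ℕ) → (ℕ → ℕ) → Prop) (c : ℕ)
    (hP : ∀ i r m, I i r m → r d ≠ 0 →
      wp P (fun σ' k => k ≤ c ∧ ∃ i' < i, I i' σ'.reg σ'.mem) ⟨r, m⟩) (i : ℕ) (h : I i r m)
    (hQ : ∀ i' r' m' k, k ≤ i * (c + 1) + 1 → r' d = 0 → I i' r' m' → Q ⟨r', m'⟩ k) :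
    wp (.loop d P) Q ⟨r, m⟩ := by
  induction i using Nat.strong_induction_on generalizing r m Q with
  | _ i ih =>
    by_cases hd : r d = 0
    · exact ⟨_, _, .loop_false hd, hQ i _ _ _ (by omega) hd h⟩
    · obtain ⟨⟨r', m'⟩, k, hP, hk, i', hi', hI⟩ := hP i r m h hd
      -- One round costs at most `c` for the body and 1 for the test, and it lowers the index by at
      -- least 1.
      have : (i' + 1) * (c + 1) ≤ i * (c + 1) := Nat.mul_le_mul_right _ hi'
      rw [add_mul] at this
      obtain ⟨σ'', l, hL, hl⟩ := ih i' hi' hI (Q := fun σ'' l => Q σ'' (k + l + 1))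
        fun i'' r'' m'' l hl hd hI' => hQ i'' r'' m'' _ (by omega) hd hI'
      exact ⟨_, _, .loop_true hd hP hL, hl⟩

/-- A loop whose control register counts down to `0`. -/
theorem wp_countdown {d : ℕ} {P : RAMProgram} (I : ℕ → (ℕ → ℕ) → (ℕ → ℕ) → Prop) (c N : ℕ)
    (hI : ∀ i r m, I i r m → r d = i)
    (hP : ∀ i < N, ∀ r m, I (i + 1) r m →
      wp P (fun σ' k => k ≤ c ∧ I i σ'.reg σ'.mem) ⟨r, m⟩) (h : I N r m)
    (hQ : ∀ r' m' k, k ≤ N * (c + 1) + 1 → I 0 r' m' → Q ⟨r', m'⟩ k) :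
    wp (.loop d P) Q ⟨r, m⟩ := by
  refine wp_loop (fun i r m => i ≤ N ∧ I i r m) c ?_ N ⟨le_rfl, h⟩ ?_
  · rintro i r m ⟨hi, h⟩ hd
    obtain ⟨j, rfl⟩ : ∃ j, i = j + 1 := Nat.exists_eq_succ_of_ne_zero (by
      have : r d = i := hI _ _ _ h
      omega)
    refine wp_mono (hP j hi r m h) ?_
    rintro σ' k ⟨hk, h⟩
    exact ⟨hk, j, by omega, by omega, h⟩
  · rintro i r' m' k hk hd ⟨-, h⟩
    have := hI _ _ _ h
    exact hQ _ _ _ hk (by rwa [hd.symm.trans this])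

end RAMProgram

/-! ## Arrays in the memory -/

/-- The arrays kept by the max-flow program: predecessors in the present flow, marks of visited
nodes, the queue of visited nodes, indices of their parents in the queue, addresses of the rows of
the adjacency matrix, the adjacency matrix, and the output. -/
structure FlowArrays where
  pred : ℕ → ℕ
  mark : ℕ → ℕ
  queue : ℕ → ℕ
  parent : ℕ → ℕ
  row : ℕ → ℕ
  adj : ℕ → ℕ → ℕ
  out : ℕ → ℕ → ℕ

/-- The memory `m` holds the arrays `g` of dimension `n`. -/
structure FlowArrays.Stored (g : FlowArrays) (n : ℕ) (m : ℕ → ℕ) : Prop where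
  pred : ∀ y < n, m y = g.pred y
  mark : ∀ y < n, m (n + n * n + n * n + y) = g.mark y
  queue : ∀ y < n, m (n + n * n + n * n + n + y) = g.queue y
  parent : ∀ y < n, m (n + n * n + n * n + n + n + y) = g.parent y
  row : ∀ y < n, m (n + n * n + n * n + n + n + n + y) = g.row y
  adj : ∀ i < n, ∀ j < n, m (n + n * i + j) = g.adj i j
  out : ∀ i < n, ∀ j < n, m (n + n * n + n * i + j) = g.out i j

theorem mul_add_lt_mul_self {n i j : ℕ} (hi : i < n) (hj : j < n) : n * i + j < n * n :=
  calc n * i + j < n * i + n := by omega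
    _ = n * (i + 1) := by ring
    _ ≤ n * n := Nat.mul_le_mul_left _ hi

theorem eq_and_eq_of_mul_add_eq {n i j i' j' : ℕ} (hj : j < n) (hj' : j' < n)
    (h : n * i + j = n * i' + j') : i = i' ∧ j = j' := by
  have hn : 0 < n := by omega
  have h1 := congrArg (· / n) h
  have h2 := congrArg (· % n) h
  simp only [Nat.mul_add_div hn, Nat.div_eq_of_lt hj, Nat.div_eq_of_lt hj', add_zero,
    Nat.mul_add_mod, Nat.mod_eq_of_lt hj, Nat.mod_eq_of_lt hj'] at h1 h2
  exact ⟨h1, h2⟩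

namespace FlowArrays.Stored

variable {g : FlowArrays} {n : ℕ} {m : ℕ → ℕ} {y v i j : ℕ}

/-- The arrays occupy disjoint address ranges, so a store changes only one of them. The array `pred`
reuses the cells of the node capacities, which the program never reads. -/
theorem store_pred (h : g.Stored n m) (hy : y < n) :
    ({g with pred := Function.update g.pred y v} : FlowArrays).Stored n
      (Function.update m y v) := by
  constructor
  · intro a ha
    simp only [Function.update_apply, h.pred a ha]
  all_goals
    intros
    rw [Function.update_of_ne (by omega)]
    simp only [*, h.mark, h.queue, h.parent, h.row, h.adj, h.out]

theorem store_mark (h : g.Stored n m) (hy : y < n) :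
    ({g with mark := Function.update g.mark y v} : FlowArrays).Stored n
      (Function.update m (n + n * n + n * n + y) v) := by
  constructor
  case mark =>
    intro a ha
    simp only [Function.update_apply, h.mark a ha, add_right_inj]
  case adj =>
    intro a ha b hb
    have := mul_add_lt_mul_self ha hb
    rw [Function.update_of_ne (by omega), h.adj a ha b hb]
  case out =>
    intro a ha b hb
    have := mul_add_lt_mul_self ha hb
    rw [Function.update_of_ne (by omega), h.out a ha b hb]
  all_goals
    intros
    rw [Function.update_of_ne (by omega)]
    simp only [*, h.pred, h.queue, h.parent, h.row]

theorem store_queue (h : g.Stored n m) (hy : y < n) :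
    ({g with queue := Function.update g.queue y v} : FlowArrays).Stored n
      (Function.update m (n + n * n + n * n + n + y) v) := by
  constructor
  case queue =>
    intro a ha
    simp only [Function.update_apply, h.queue a ha, add_right_inj]
  case adj =>
    intro a ha b hb
    have := mul_add_lt_mul_self ha hb
    rw [Function.update_of_ne (by omega), h.adj a ha b hb]
  case out =>
    intro a ha b hb
    have := mul_add_lt_mul_self ha hb
    rw [Function.update_of_ne (by omega), h.out a ha b hb]
  all_goals
    intros
    rw [Function.update_of_ne (by omega)]
    simp only [*, h.pred, h.mark, h.parent, h.row]

theorem store_parent (h : g.Stored n m) (hy : y < n) :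
    ({g with parent := Function.update g.parent y v} : FlowArrays).Stored n
      (Function.update m (n + n * n + n * n + n + n + y) v) := by
  constructor
  case parent =>
    intro a ha
    simp only [Function.update_apply, h.parent a ha, add_right_inj]
  case adj =>
    intro a ha b hb
    have := mul_add_lt_mul_self ha hb
    rw [Function.update_of_ne (by omega), h.adj a ha b hb]
  case out =>
    intro a ha b hb
    have := mul_add_lt_mul_self ha hb
    rw [Function.update_of_ne (by omega), h.out a ha b hb]
  all_goals
    intros
    rw [Function.update_of_ne (by omega)]
    simp only [*, h.pred, h.mark, h.queue, h.row]

theorem store_row (h : g.Stored n m) (hy : y < n) :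
    ({g with row := Function.update g.row y v} : FlowArrays).Stored n
      (Function.update m (n + n * n + n * n + n + n + n + y) v) := by
  constructor
  case row =>
    intro a ha
    simp only [Function.update_apply, h.row a ha, add_right_inj]
  case adj =>
    intro a ha b hb
    have := mul_add_lt_mul_self ha hb
    rw [Function.update_of_ne (by omega), h.adj a ha b hb]
  case out =>
    intro a ha b hb
    have := mul_add_lt_mul_self ha hb
    rw [Function.update_of_ne (by omega), h.out a ha b hb]
  all_goals
    intros
    rw [Function.update_of_ne (by omega)]
    simp only [*, h.pred, h.mark, h.queue, h.parent]

theorem store_adj (h : g.Stored n m) (hi : i < n) (hj : j < n) :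
    ({g with adj := fun a b => if a = i ∧ b = j then v else g.adj a b} : FlowArrays).Stored n
      (Function.update m (n + n * i + j) v) := by
  have hij := mul_add_lt_mul_self hi hj
  constructor
  case adj =>
    intro a ha b hb
    by_cases hab : a = i ∧ b = j
    · obtain ⟨rfl, rfl⟩ := hab
      simp
    · rw [Function.update_of_ne, h.adj a ha b hb]
      · exact (if_neg hab).symm
      · exact fun h' => hab (eq_and_eq_of_mul_add_eq hb hj (by omega))
  case out =>
    intro a ha b hb
    rw [Function.update_of_ne (by omega), h.out a ha b hb]
  all_goals
    intros
    rw [Function.update_of_ne (by omega)]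
    simp only [*, h.pred, h.mark, h.queue, h.parent, h.row]

theorem store_out (h : g.Stored n m) (hi : i < n) (hj : j < n) :
    ({g with out := fun a b => if a = i ∧ b = j then v else g.out a b} : FlowArrays).Stored n
      (Function.update m (n + n * n + n * i + j) v) := by
  have hij := mul_add_lt_mul_self hi hj
  constructor
  case out =>
    intro a ha b hb
    by_cases hab : a = i ∧ b = j
    · obtain ⟨rfl, rfl⟩ := hab
      simp
    · rw [Function.update_of_ne, h.out a ha b hb]
      · exact (if_neg hab).symm
      · exact fun h' => hab (eq_and_eq_of_mul_add_eq hb hj (by omega))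
  case adj =>
    intro a ha b hb
    have := mul_add_lt_mul_self ha hb
    rw [Function.update_of_ne (by omega), h.adj a ha b hb]
  all_goals
    intros
    rw [Function.update_of_ne (by omega)]
    simp only [*, h.pred, h.mark, h.queue, h.parent, h.row]

end FlowArrays.Stored

/-! ### Constant registers and initialization -/

/-- The registers that keep their values while the max-flow program runs. -/
structure FlowRegisters (n s t : ℕ) (r : ℕ → ℕ) : Prop where
  dim : r 0 = n
  source : r 1 = s
  sink : r 2 = t
  one : r 3 = 1
  zero : r 4 = 0
  mark : r 5 = n + n * n + n * n
  queue : r 6 = n + n * n + n * n + n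
  parent : r 7 = n + n * n + n * n + n + n
  row : r 8 = n + n * n + n * n + n + n + n
  square : r 9 = n * n

/-- Registers from 10 on are scratch space. -/
theorem FlowRegisters.update {n s t : ℕ} {r : ℕ → ℕ} (h : FlowRegisters n s t r) {i : ℕ}
    (hi : 10 ≤ i) (v : ℕ) : FlowRegisters n s t (Function.update r i v) := by
  constructor <;> rw [Function.update_of_ne (by omega)]
  exacts [h.dim, h.source, h.sink, h.one, h.zero, h.mark, h.queue, h.parent, h.row, h.square]

set_option linter.unusedSimpArgs false

namespace RAMProgram

/-- Set the constant registers. -/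
def setRegisters : RAMProgram := block
  [.const 3 1, .add 10 0 4, .loop 10 (block [.sub 10 10 3, .add 9 9 0]),
    .add 5 0 9, .add 5 5 9, .add 6 5 0, .add 7 6 0, .add 8 7 0]

/-- The machine cannot multiply, so `n * n` is accumulated by `n` additions. Register 4, which is
still zero, turns addition into copying. -/
theorem wp_setRegisters {Q : RAMState → ℕ → Prop} {n s t : ℕ} {r m : ℕ → ℕ}
    (h0 : r 0 = n) (h1 : r 1 = s) (h2 : r 2 = t) (h4 : r 4 = 0) (h9 : r 9 = 0)
    (hQ : ∀ r' k, k ≤ 4 * n + 9 → FlowRegisters n s t r' → Q ⟨r', m⟩ k) :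
    wp setRegisters Q ⟨r, m⟩ := by
  simp only [setRegisters, wp_block_cons, wp_const, wp_add, wp_sub, Function.update_self,
    Function.update_of_ne, ne_eq, Nat.reduceEqDiff, not_false_eq_true]
  refine wp_countdown (fun i r' m' => r' 10 = i ∧ r' 9 + n * i = n * n ∧ r' 0 = n ∧
    r' 1 = s ∧ r' 2 = t ∧ r' 3 = 1 ∧ r' 4 = 0 ∧ m' = m) 3 n ?_ ?_ ?_ ?_
  · rintro i r m ⟨h, -⟩; exact h
  · rintro i hi r' m' ⟨h10, h9, h0, h1, h2, h3, h4, hm⟩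
    simp only [wp_block_cons, wp_block_nil, wp_const, wp_add, wp_sub, Function.update_self,
      Function.update_of_ne, ne_eq, Nat.reduceEqDiff, not_false_eq_true]
    simp [*]
    rw [← h9]; ring
  · simp [*]
  · rintro r' m' k hk ⟨h10, h9, h0, h1, h2, h3, h4, rfl⟩
    simp only [wp_block_cons, wp_block_nil, wp_const, wp_add, wp_sub, Function.update_self,
      Function.update_of_ne, ne_eq, Nat.reduceEqDiff, not_false_eq_true]
    refine hQ _ _ (by omega) ?_
    simp only [mul_zero, add_zero] at h9
    constructor <;> simp [*]


/-- Fill in the addresses of the rows, add the diagonal to the adjacency matrix, and let every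
node be its own predecessor. -/
def initArrays : RAMProgram := block
  [.add 11 0 9, .add 10 0 4,
    .loop 10 (block [.sub 10 10 3, .sub 11 11 0, .add 12 8 10, .store 12 11, .add 12 11 10,
      .store 12 3, .store 10 10])]

/-- The array `row` exists to avoid multiplication when a matrix entry is addressed. The diagonal is
added so that keeping an unused node as its own predecessor counts as a legal step. -/
theorem wp_initArrays {Q : RAMState → ℕ → Prop} {n s t : ℕ} {r m : ℕ → ℕ}
    (hr : FlowRegisters n s t r)
    (hQ : ∀ r' m' k (g : FlowArrays), k ≤ 9 * n + 4 → FlowRegisters n s t r' → g.Stored n m' →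
      (∀ y < n, g.pred y = y) → (∀ y < n, g.row y = n + n * y) →
      (∀ i < n, ∀ j < n, g.adj i j ≠ 0 ↔ i = j ∨ m (n + n * i + j) ≠ 0) →
      (∀ i < n, ∀ j < n, g.out i j = m (n + n * n + n * i + j)) → Q ⟨r', m'⟩ k) :
    wp initArrays Q ⟨r, m⟩ := by
  simp only [initArrays]
  simp only [wp_block_cons, wp_block_nil, wp_const, wp_add, wp_sub, wp_load, wp_store, wp_ite,
    wp_skip, Function.update_self, Function.update_of_ne, ne_eq, Nat.reduceEqDiff,
    not_false_eq_true]
  refine wp_countdown (fun i r' m' => FlowRegisters n s t r' ∧ r' 10 = i ∧ r' 11 = n + n * i ∧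
    ∃ g : FlowArrays, g.Stored n m' ∧ (∀ y < n, i ≤ y → g.pred y = y ∧ g.row y = n + n * y) ∧
      (∀ a < n, ∀ b < n, g.adj a b ≠ 0 ↔ (a = b ∧ i ≤ a) ∨ m (n + n * a + b) ≠ 0) ∧
      (∀ a < n, ∀ b < n, g.out a b = m (n + n * n + n * a + b))) 8 n ?_ ?_ ?_ ?_
  · rintro i r m ⟨-, h, -⟩; exact h
  · rintro i hi r' m' ⟨hr, h10, h11, g, hg, hpr, hadj, hout⟩
    simp only [wp_block_cons, wp_block_nil, wp_const, wp_add, wp_sub, wp_load, wp_store, wp_ite,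
      wp_skip, Function.update_self, Function.update_of_ne, ne_eq, Nat.reduceEqDiff,
      not_false_eq_true]
    have e : r' 11 - r' 0 = n + n * i := by rw [h11, hr.dim, mul_add]; omega
    simp only [h10, hr.one, e, hr.row, Nat.add_sub_cancel]
    refine ⟨by norm_num, ?_, trivial, trivial, _, ((hg.store_row hi).store_adj hi hi).store_pred hi,
      ?_, ?_, hout⟩
    · exact (((hr.update (by norm_num) _).update (by norm_num) _).update (by norm_num) _).update
        (by norm_num) _
    · intro y hy hiy
      by_cases h : y = i
      · subst h; simp
      · simpa [Function.update_of_ne h] using hpr y hy (by omega)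
    · intro a ha b hb
      by_cases h : a = i ∧ b = i
      · simp [h]
      · have h' : (a = b ∧ i ≤ a) ↔ (a = b ∧ i + 1 ≤ a) := by omega
        simpa [h, h'] using hadj a ha b hb
  -- Any memory stores the arrays that are read off from it.
  · refine ⟨(hr.update (by norm_num) _).update (by norm_num) _, by simp [hr.dim, hr.zero],
      by simp [hr.dim, hr.square], ⟨m, fun y => m (n + n * n + n * n + y),
      fun y => m (n + n * n + n * n + n + y), fun y => m (n + n * n + n * n + n + n + y),
      fun y => m (n + n * n + n * n + n + n + n + y), fun i j => m (n + n * i + j),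
      fun i j => m (n + n * n + n * i + j)⟩, ?_, ?_, ?_, ?_⟩
    · constructor <;> intros <;> rfl
    · intro y hy hy'; omega
    · intro a ha b hb
      have : ¬ (a = b ∧ n ≤ a) := by omega
      simp [this]
    · intros; rfl
  · rintro r' m' k hk ⟨hr, h10, h11, g, hg, hpr, hadj, hout⟩
    refine hQ _ _ _ g (by omega) hr hg (fun y hy => (hpr y hy (Nat.zero_le _)).1)
      (fun y hy => (hpr y hy (Nat.zero_le _)).2) (fun a ha b hb => ?_) hout
    simp [hadj a ha b hb]

/-- Unmark all nodes. -/
def clearMarks : RAMProgram := block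
  [.add 10 0 4, .loop 10 (block [.sub 10 10 3, .add 12 5 10, .store 12 4])]

theorem wp_clearMarks {Q : RAMState → ℕ → Prop} {n s t : ℕ} {r m : ℕ → ℕ} {g : FlowArrays}
    (hr : FlowRegisters n s t r) (hg : g.Stored n m)
    (hQ : ∀ r' m' k mark, k ≤ 5 * n + 3 → FlowRegisters n s t r' →
      ({g with mark := mark} : FlowArrays).Stored n m' → (∀ y < n, mark y = 0) → Q ⟨r', m'⟩ k) :
    wp clearMarks Q ⟨r, m⟩ := by
  simp only [clearMarks]
  simp only [wp_block_cons, wp_block_nil, wp_const, wp_add, wp_sub, wp_load, wp_store, wp_ite,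
    wp_skip, Function.update_self, Function.update_of_ne, ne_eq, Nat.reduceEqDiff,
    not_false_eq_true]
  refine wp_countdown (fun i r' m' => FlowRegisters n s t r' ∧ r' 10 = i ∧
    ∃ mark, ({g with mark := mark} : FlowArrays).Stored n m' ∧
      ∀ y < n, i ≤ y → mark y = 0) 4 n ?_ ?_ ?_ ?_
  · rintro i r m ⟨-, h, -⟩; exact h
  · rintro i hi r' m' ⟨hr, h10, mark, hg, hm⟩
    simp only [wp_block_cons, wp_block_nil, wp_const, wp_add, wp_sub, wp_load, wp_store, wp_ite,
      wp_skip, Function.update_self, Function.update_of_ne, ne_eq, Nat.reduceEqDiff,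
      not_false_eq_true]
    simp only [h10, hr.one, hr.zero, hr.mark, Nat.add_sub_cancel]
    refine ⟨by norm_num, (hr.update (by norm_num) _).update (by norm_num) _, trivial, _,
      hg.store_mark hi, ?_⟩
    intro y hy hiy
    by_cases h : y = i
    · subst h; simp
    · simpa [Function.update_of_ne h] using hm y hy (by omega)
  · exact ⟨hr.update (by norm_num) _, by simp [hr.dim, hr.zero], g.mark, hg,
      fun y hy hy' => by omega⟩
  · rintro r' m' k hk ⟨hr, h10, mark, hg, hm⟩
    exact hQ _ _ _ mark (by omega) hr hg fun y hy => hm y hy (Nat.zero_le _)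

end RAMProgram

/-! ### Search for an augmenting path -/

/-- The first `l` entries of `queue` are distinct marked nodes, found by a search from `s` that
continues from `a` to all `z` with `adj (pred a) z ≠ 0`. -/
structure SearchQueue (n s t : ℕ) (g : FlowArrays) (l : ℕ) : Prop where
  pos : 0 < l
  first : g.queue 0 = s
  lt : ∀ k < l, g.queue k < n
  ne_sink : ∀ k < l, g.queue k ≠ t
  inj : ∀ i < l, ∀ j < l, g.queue i = g.queue j → i = j
  mark : ∀ z < n, g.mark z ≠ 0 ↔ ∃ k < l, g.queue k = z
  parent : ∀ k < l, 0 < k →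
    g.parent k < k ∧ g.adj (g.pred (g.queue (g.parent k))) (g.queue k) ≠ 0

namespace SearchQueue

variable {n s t l : ℕ} {g : FlowArrays}

/-- The entries are distinct numbers below `n`; this keeps the queue inside its memory area and
bounds the number of search rounds. -/
theorem le_dim (h : SearchQueue n s t g l) : l ≤ n := by
  have := Finset.card_le_card_of_injOn (s := Finset.range l) (t := Finset.range n) g.queue
    (fun k hk => by simpa using h.lt k (by simpa using hk))
    (fun i hi j hj => h.inj i (by simpa using hi) j (by simpa using hj))
  simpa using this

theorem push (h : SearchQueue n s t g l) {k z : ℕ} (hk : k < l) (hz : z < n) (hzt : z ≠ t)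
    (hm : g.mark z = 0) (hkz : g.adj (g.pred (g.queue k)) z ≠ 0) :
    SearchQueue n s t {g with
      mark := Function.update g.mark z 1
      queue := Function.update g.queue l z
      parent := Function.update g.parent l k} (l + 1) := by
  have hz' : ∀ k < l, g.queue k ≠ z := fun k hk e => (h.mark z hz).2 ⟨k, hk, e⟩ hm
  constructor
  · omega
  · simpa [Function.update_of_ne h.pos.ne] using h.first
  · intro i hi
    rcases Nat.lt_succ_iff_lt_or_eq.1 hi with hi | rfl
    · simpa [Function.update_of_ne hi.ne] using h.lt i hi
    · simpa using hz
  · intro i hi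
    rcases Nat.lt_succ_iff_lt_or_eq.1 hi with hi | rfl
    · simpa [Function.update_of_ne hi.ne] using h.ne_sink i hi
    · simpa using hzt
  · intro i hi j hj
    rcases Nat.lt_succ_iff_lt_or_eq.1 hi with hi | rfl <;>
      rcases Nat.lt_succ_iff_lt_or_eq.1 hj with hj | rfl
    · simpa [Function.update_of_ne hi.ne, Function.update_of_ne hj.ne] using h.inj i hi j hj
    · simpa [Function.update_of_ne hi.ne] using fun e => absurd e (hz' i hi)
    · simpa [Function.update_of_ne hj.ne] using fun e => absurd e.symm (hz' j hj)
    · simp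
  · intro y hy
    constructor
    · intro hy'
      by_cases e : y = z
      · exact ⟨l, by omega, by simp [e]⟩
      · obtain ⟨i, hi, e'⟩ := (h.mark y hy).1 (by simpa [Function.update_of_ne e] using hy')
        exact ⟨i, by omega, by simpa [Function.update_of_ne hi.ne] using e'⟩
    · rintro ⟨i, hi, e⟩
      by_cases e' : y = z
      · simp [e']
      · simp only [Function.update_of_ne e']
        rcases Nat.lt_succ_iff_lt_or_eq.1 hi with hi | rfl
        · exact (h.mark y hy).2 ⟨i, hi, by simpa [Function.update_of_ne hi.ne] using e⟩
        · simp at e; omega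
  · intro i hi h0
    rcases Nat.lt_succ_iff_lt_or_eq.1 hi with hi | rfl
    · have := h.parent i hi h0
      simpa [Function.update_of_ne hi.ne, Function.update_of_ne (this.1.trans hi).ne] using this
    · simpa [Function.update_of_ne hk.ne] using ⟨hk, hkz⟩

end SearchQueue

/-- The search has left the first `l` entries of the queue behind. -/
def FlowArrays.Scanned (n t : ℕ) (g : FlowArrays) (l : ℕ) : Prop :=
  ∀ k < l, g.adj (g.pred (g.queue k)) t = 0 ∧
    ∀ z < n, g.adj (g.pred (g.queue k)) z ≠ 0 → g.mark z ≠ 0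

namespace RAMProgram

/-- Append the unmarked nodes found in one row of the adjacency matrix to the queue. -/
def scanRow : RAMProgram := block
  [.add 10 0 4, .loop 10 (block [.sub 10 10 3, .add 12 17 10, .load 12 12,
    .ite 12
      (block [.add 18 5 10, .load 12 18,
        .ite 12 .skip
          (block [.store 18 3, .add 12 6 14, .store 12 10, .add 12 7 14, .store 12 13,
            .add 14 14 3])])
      .skip])]

/-- Register 13 is the head of the queue, 14 its end, 15 the success flag, and 17 the address of the
scanned row. The assumption `ht` keeps `t` out of the queue. -/
theorem wp_scanRow {Q : RAMState → ℕ → Prop} {n s t : ℕ} {r m : ℕ → ℕ} {g : FlowArrays}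
    {h l : ℕ} (hr : FlowRegisters n s t r) (hg : g.Stored n m) (h13 : r 13 = h) (h14 : r 14 = l)
    (h17 : r 17 = n + n * g.pred (g.queue h)) (hx : g.pred (g.queue h) < n) (hhl : h < l)
    (hq : SearchQueue n s t g l) (hs : g.Scanned n t h)
    (ht : g.adj (g.pred (g.queue h)) t = 0)
    (hQ : ∀ r' m' k mark queue parent l', k ≤ 20 * n + 3 → FlowRegisters n s t r' →
      ({g with mark := mark, queue := queue, parent := parent} : FlowArrays).Stored n m' →
      r' 13 = h → r' 14 = l' → r' 15 = r 15 → h < l' →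
      SearchQueue n s t {g with mark := mark, queue := queue, parent := parent} l' →
      ({g with mark := mark, queue := queue, parent := parent} : FlowArrays).Scanned n t (h + 1) →
      Q ⟨r', m'⟩ k) :
    wp scanRow Q ⟨r, m⟩ := by
  simp only [scanRow]
  simp only [wp_block_cons, wp_block_nil, wp_const, wp_add, wp_sub, wp_load, wp_store, wp_ite,
    wp_skip, Function.update_self, Function.update_of_ne, ne_eq, Nat.reduceEqDiff,
    not_false_eq_true]
  refine wp_countdown (fun i r' m' => FlowRegisters n s t r' ∧ r' 10 = i ∧
    ∃ mark queue parent l', ({g with mark := mark, queue := queue, parent := parent} :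
      FlowArrays).Stored n m' ∧ r' 13 = h ∧ r' 14 = l' ∧ r' 15 = r 15 ∧
      r' 17 = n + n * g.pred (g.queue h) ∧ queue h = g.queue h ∧ h < l' ∧
      SearchQueue n s t {g with mark := mark, queue := queue, parent := parent} l' ∧
      ({g with mark := mark, queue := queue, parent := parent} : FlowArrays).Scanned n t h ∧
      ∀ z < n, i ≤ z → g.adj (g.pred (g.queue h)) z ≠ 0 → mark z ≠ 0) 19 n ?_ ?_ ?_ ?_
  · rintro i r m ⟨-, h, -⟩; exact h
  · rintro i hi r' m' ⟨hr, h10, mark, queue, parent, l', hg, h13, h14, h15, h17, hqh, hhl, hq, hs,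
      hz⟩
    have hadj := hg.adj _ hx i hi
    have hmark := hg.mark i hi
    simp only [wp_block_cons, wp_block_nil, wp_const, wp_add, wp_sub, wp_load, wp_store, wp_ite,
      wp_skip, Function.update_self, Function.update_of_ne, ne_eq, Nat.reduceEqDiff,
      not_false_eq_true]
    simp only [h10, h13, h14, h15, h17, hr.one, hr.mark, hr.queue, hr.parent, Nat.add_sub_cancel,
      hadj, hmark]
    have hnext : ∀ z < n, i ≤ z → (z = i → mark z ≠ 0 ∨ g.adj (g.pred (g.queue h)) z = 0) →
        g.adj (g.pred (g.queue h)) z ≠ 0 → mark z ≠ 0 := by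
      intro z hz1 hz2 hz3 hz4
      rcases hz2.eq_or_lt with rfl | hlt
      · exact (hz3 rfl).resolve_right hz4
      · exact hz z hz1 hlt hz4
    refine ⟨fun ha => ⟨fun hm => ?_, fun hm => ?_⟩, fun ha => ?_⟩
    · refine ⟨by norm_num, ?_, trivial, mark, queue, parent, l', hg, trivial, rfl, trivial, trivial, hqh, hhl,
        hq, hs, fun z hz1 hz2 => hnext z hz1 hz2 fun e => .inl (e ▸ hm)⟩
      exact (((hr.update (by norm_num) _).update (by norm_num) _).update (by norm_num) _).update
        (by norm_num) _ |>.update (by norm_num) _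
    · have hq' := hq.push (k := h) hhl hi (fun e => ha (e ▸ ht)) hm (by simpa [hqh] using ha)
      -- The enlarged queue still has at most `n` entries, so the stores at position `l'` stay
      -- within the arrays.
      have hl' : l' < n := hq'.le_dim
      refine ⟨by norm_num, ?_, trivial, Function.update mark i 1, Function.update queue l' i,
        Function.update parent l' h, l' + 1,
        ((hg.store_mark hi).store_queue hl').store_parent hl', trivial, rfl, trivial, trivial, ?_,
        by omega, hq', ?_, ?_⟩
      · exact ((((hr.update (by norm_num) _).update (by norm_num) _).update (by norm_num) _).update
          (by norm_num) _ |>.update (by norm_num) _).update (by norm_num) _ |>.update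
          (by norm_num) _ |>.update (by norm_num) _
      · rw [Function.update_of_ne hhl.ne, hqh]
      · intro k hk
        have := hs k hk
        simp only [Function.update_of_ne (hk.trans hhl).ne]
        refine ⟨this.1, fun z hz hza => ?_⟩
        by_cases e : z = i
        · simp [e]
        · simpa [Function.update_of_ne e] using this.2 z hz hza
      · intro z hz1 hz2 hza
        by_cases e : z = i
        · simp [e]
        · simpa [Function.update_of_ne e] using hz z hz1 (by omega) hza
    · refine ⟨by norm_num, ?_, trivial, mark, queue, parent, l', hg, trivial, rfl, trivial, trivial, hqh, hhl,
        hq, hs, fun z hz1 hz2 => hnext z hz1 hz2 fun e => .inr (e ▸ ha)⟩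
      exact ((hr.update (by norm_num) _).update (by norm_num) _).update (by norm_num) _
  · refine ⟨hr.update (by norm_num) _, by simp [hr.dim, hr.zero], g.mark, g.queue, g.parent, l, hg,
      h13, h14, rfl, h17, rfl, hhl, hq, hs, fun z hz hz' => by omega⟩
  · rintro r' m' k hk ⟨hr, h10, mark, queue, parent, l', hg, h13, h14, h15, h17, hqh, hhl, hq, hs,
      hz⟩
    refine hQ _ _ _ mark queue parent l' (by omega) hr hg h13 h14 h15 hhl hq ?_
    intro k hk
    rcases Nat.lt_succ_iff_lt_or_eq.1 hk with hk | rfl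
    · exact hs k hk
    · exact ⟨by simpa [hqh] using ht, fun z hz' hza => hz z hz' (Nat.zero_le _)
        (by simpa [hqh] using hza)⟩

/-- Search for a node `k` in the queue from which the present flow can be augmented. -/
def search : RAMProgram := block
  [clearMarks, .add 12 5 1, .store 12 3, .store 6 1, .const 13 0, .const 14 1, .const 15 0,
    .const 16 1,
    .loop 16 (block [.add 12 6 13, .load 17 12, .load 17 17, .add 12 8 17, .load 17 12,
      .add 12 17 2, .load 12 12,
      .ite 12 (block [.const 15 1, .const 16 0])
        (block [scanRow, .add 13 13 3, .sub 16 14 13])])]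

/-- Each queue entry is scanned once, through a row of length `n`, which gives the quadratic bound.
Register 16 keeps the loop running; the truncated difference of the end and the head vanishes
exactly when the queue is exhausted. -/
theorem wp_search {Q : RAMState → ℕ → Prop} {n s t : ℕ} {r m : ℕ → ℕ} {g : FlowArrays}
    (hr : FlowRegisters n s t r) (hg : g.Stored n m) (hs : s < n) (ht : t < n) (hst : s ≠ t)
    (hrow : ∀ y < n, g.row y = n + n * y) (hpred : ∀ y < n, g.pred y < n)
    (hQ : ∀ r' m' k mark queue parent h l, k ≤ 46 * (n * n) + 20 → FlowRegisters n s t r' →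
      ({g with mark := mark, queue := queue, parent := parent} : FlowArrays).Stored n m' →
      r' 13 = h →
      SearchQueue n s t {g with mark := mark, queue := queue, parent := parent} l →
      (r' 15 = 0 ∧ ({g with mark := mark, queue := queue, parent := parent} :
        FlowArrays).Scanned n t l ∨
        r' 15 = 1 ∧ h < l ∧ g.adj (g.pred (queue h)) t ≠ 0) → Q ⟨r', m'⟩ k) :
    wp search Q ⟨r, m⟩ := by
  simp only [search]
  rw [wp_block_cons]
  refine wp_clearMarks hr hg fun r m k₀ mark hk₀ hr hg hm => ?_
  simp only [wp_block_cons, wp_block_nil, wp_const, wp_add, wp_sub, wp_load, wp_store, wp_ite,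
    wp_skip, Function.update_self, Function.update_of_ne, ne_eq, Nat.reduceEqDiff,
    not_false_eq_true]
  rw [hr.mark, hr.queue, hr.source, hr.one]
  -- The three cases are: still running, queue exhausted, and edge to `t` found. While running, the
  -- index counts the `n - h` possible remaining entries.
  refine wp_loop (fun i r' m' => FlowRegisters n s t r' ∧
    ∃ mark queue parent h l, ({g with mark := mark, queue := queue, parent := parent} :
      FlowArrays).Stored n m' ∧ r' 13 = h ∧ r' 14 = l ∧
      SearchQueue n s t {g with mark := mark, queue := queue, parent := parent} l ∧
      ({g with mark := mark, queue := queue, parent := parent} : FlowArrays).Scanned n t h ∧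
      (r' 16 ≠ 0 ∧ r' 15 = 0 ∧ h < l ∧ i + h = n ∨
        r' 16 = 0 ∧ r' 15 = 0 ∧ h = l ∨
        r' 16 = 0 ∧ r' 15 = 1 ∧ h < l ∧ g.adj (g.pred (queue h)) t ≠ 0)) (20 * n + 20) ?_ n ?_ ?_
  · rintro i r m ⟨hr, mark, queue, parent, h, l, hg, h13, h14, hq, hsc, hc⟩ h16
    obtain ⟨-, h15, hhl, hin⟩ := hc.resolve_right (by simp [h16])
    have hln := hq.le_dim
    have hqn : queue h < n := hq.lt h hhl
    have hpn := hpred _ hqn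
    have e1 := hg.queue h (by omega)
    have e2 := hg.pred _ hqn
    have e3 := hg.row _ hpn
    have e4 := hg.adj _ hpn t ht
    simp only [hrow _ hpn] at e1 e2 e3 e4
    simp only [wp_block_cons, wp_block_nil, wp_const, wp_add, wp_sub, wp_load, wp_store, wp_ite,
      wp_skip, Function.update_self, Function.update_of_ne, ne_eq, Nat.reduceEqDiff,
      not_false_eq_true]
    simp only [h13, hr.queue, hr.row, hr.sink, e1, e2, e3, e4]
    refine ⟨fun hat => ?_, fun hat => ?_⟩
    · refine ⟨by omega, 0, by omega, ?_, mark, queue, parent, h, l, hg, rfl, h14, hq, hsc,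
        .inr (.inr ⟨trivial, trivial, hhl, hat⟩)⟩
      exact (((hr.update (by norm_num) _).update (by norm_num) _).update (by norm_num) _).update
        (by norm_num) _ |>.update (by norm_num) _ |>.update (by norm_num) _ |>.update
        (by norm_num) _ |>.update (by norm_num) _ |>.update (by norm_num) _
    · refine wp_scanRow (h := h) (l := l) (g := {g with mark := mark, queue := queue, parent := parent}) ?_ hg
        ?_ ?_ ?_ hpn hhl hq hsc hat ?_
      · exact (((hr.update (by norm_num) _).update (by norm_num) _).update (by norm_num) _).update
          (by norm_num) _ |>.update (by norm_num) _ |>.update (by norm_num) _ |>.update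
          (by norm_num) _
      · simp only [wp_block_cons, wp_block_nil, wp_const, wp_add, wp_sub, wp_load, wp_store, wp_ite,
          wp_skip, Function.update_self, Function.update_of_ne, ne_eq, Nat.reduceEqDiff,
          not_false_eq_true]
        exact h13
      · simp only [wp_block_cons, wp_block_nil, wp_const, wp_add, wp_sub, wp_load, wp_store, wp_ite,
          wp_skip, Function.update_self, Function.update_of_ne, ne_eq, Nat.reduceEqDiff,
          not_false_eq_true]
        exact h14
      · simp only [wp_block_cons, wp_block_nil, wp_const, wp_add, wp_sub, wp_load, wp_store, wp_ite,
          wp_skip, Function.update_self, Function.update_of_ne, ne_eq, Nat.reduceEqDiff,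
          not_false_eq_true]
      · intro r' m' k mark queue parent l' hk hr hg h13 h14 h15 hhl hq hsc
        simp only [wp_block_cons, wp_block_nil, wp_const, wp_add, wp_sub, wp_load, wp_store, wp_ite,
          wp_skip, Function.update_self, Function.update_of_ne, ne_eq, Nat.reduceEqDiff,
          not_false_eq_true]
        simp only [h13, h14, hr.one]
        refine ⟨by omega, i - 1, by omega, (hr.update (by norm_num) _).update (by norm_num) _,
          mark, queue, parent, h + 1, l', hg, rfl, rfl, hq, hsc, ?_⟩
        rw [h15]
        simp only [wp_block_cons, wp_block_nil, wp_const, wp_add, wp_sub, wp_load, wp_store, wp_ite,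
          wp_skip, Function.update_self, Function.update_of_ne, ne_eq, Nat.reduceEqDiff,
          not_false_eq_true]
        have := hq.le_dim
        omega
  · refine ⟨?_, Function.update mark s 1, Function.update g.queue 0 s, g.parent, 0, 1,
      (hg.store_mark hs).store_queue (y := 0) (by omega), by simp, by simp, ?_, ?_, ?_⟩
    · exact (((hr.update (by norm_num) _).update (by norm_num) _).update (by norm_num) _).update
        (by norm_num) _ |>.update (by norm_num) _
    · constructor
      · norm_num
      · simp
      · intro k hk; obtain rfl : k = 0 := by omega
        simpa using hs
      · intro k hk; obtain rfl : k = 0 := by omega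
        simpa using hst
      · intro i hi j hj _; omega
      · intro z hz
        by_cases e : z = s
        · subst e
          simp only [Function.update_self]
          exact ⟨fun _ => ⟨0, by norm_num, by simp⟩, fun _ => by norm_num⟩
        · simp only [Function.update_of_ne e, hm z hz]
          refine ⟨fun h => absurd rfl h, ?_⟩
          rintro ⟨k, hk, e'⟩
          obtain rfl : k = 0 := by omega
          simp at e'
          exact absurd e'.symm e
      · intro k hk hk'; omega
    · intro k hk; omega
    · left
      simp
  · rintro i r' m' k hk h16 ⟨hr, mark, queue, parent, h, l, hg, h13, h14, hq, hsc, hc⟩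
    have hn : n ≤ n * n := Nat.le_mul_self n
    have hn' : n * (20 * n + 20 + 1) = 20 * (n * n) + 21 * n := by ring
    refine hQ _ _ _ mark queue parent h l (by omega) hr hg h13 hq ?_
    rcases hc with hc | ⟨-, hc, rfl⟩ | hc
    · exact absurd h16 hc.1
    · exact .inl ⟨hc, hsc⟩
    · exact .inr hc.2

end RAMProgram

/-! ### Linkages with a hole, and augmentation -/

/-- Vertex-disjoint paths from `s` to `t` (and cycles) on the nodes below `n`, given by the
predecessor `p a` of each node `a`, where `p a = a` if `a` is not used. The value of `p` at `y` is
ignored, unless `y = s`. The relation `A a b ≠ 0` consists of the edges and the diagonal. -/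
structure PartialLinkage (n s t : ℕ) (A : ℕ → ℕ → ℕ) (p : ℕ → ℕ) (y : ℕ) : Prop where
  source : p s = s
  sink : p t = t
  lt : ∀ a < n, p a < n
  inj : ∀ a < n, (a ≠ y ∨ a = s) → ∀ b < n, (b ≠ y ∨ b = s) → p a = p b → p a ≠ s → a = b
  step : ∀ a < n, (a ≠ y ∨ a = s) → A (p a) a ≠ 0
  last : ∀ x < n, (∀ a < n, (a ≠ y ∨ a = s) → p a ≠ x) → A x t ≠ 0

namespace PartialLinkage

variable {n s t : ℕ} {A : ℕ → ℕ → ℕ} {p : ℕ → ℕ} {y : ℕ}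

theorem id (hd : ∀ a < n, A a a ≠ 0) : PartialLinkage n s t A (fun a => a) s where
  source := rfl
  sink := rfl
  lt _ h := h
  inj _ _ _ _ _ _ h _ := h
  step a ha _ := hd a ha
  last x hx h := absurd rfl (h x hx (by omega))

theorem congr (h : PartialLinkage n s t A p y) {p' : ℕ → ℕ} (hs : s < n) (ht : t < n)
    (hp : ∀ a < n, p' a = p a) : PartialLinkage n s t A p' y where
  source := by rw [hp s hs, h.source]
  sink := by rw [hp t ht, h.sink]
  lt a ha := by rw [hp a ha]; exact h.lt a ha
  inj a ha ha' b hb hb' := by rw [hp a ha, hp b hb]; exact h.inj a ha ha' b hb hb'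
  step a ha ha' := by rw [hp a ha]; exact h.step a ha ha'
  last x hx hx' := h.last x hx fun a ha ha' => by rw [← hp a ha]; exact hx' a ha ha'

/-- A linkage may be extended to `t` from the node that precedes `y`, giving up its edge to `y`. -/
theorem extend (h : PartialLinkage n s t A p s) (hy : A (p y) t ≠ 0) :
    PartialLinkage n s t A p y where
  source := h.source
  sink := h.sink
  lt := h.lt
  inj a ha _ b hb _ := h.inj a ha (by omega) b hb (by omega)
  step a ha _ := h.step a ha (by omega)
  last x hx hx' := by
    by_cases e : p y = x
    · rwa [← e]
    · refine h.last x hx fun a ha _ => ?_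
      by_cases e' : a = y
      · rwa [e']
      · exact hx' a ha (.inl e')

/-- The hole moves one step back along the search tree: `y` takes over the predecessor of `w`, and
`w` is left without one. Injectivity survives because no live node other than `w` had that
predecessor, unless it is `s`. The set of values at live nodes is unchanged, so no path loses its
end. Once the hole reaches `s` there is no hole any more. -/
theorem shift (h : PartialLinkage n s t A p y) {w : ℕ} (hy : y < n) (hw : w < n) (hwy : w ≠ y)
    (hys : y ≠ s) (hyt : y ≠ t) (hA : A (p w) y ≠ 0) :
    PartialLinkage n s t A (Function.update p y (p w)) w := by
  have key : ∀ b < n, b ≠ y → (b ≠ w ∨ b = s) → p w = p b → p b ≠ s → False := by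
    intro b hb hby hb' e hbs
    have := h.inj w hw (.inl hwy) b hb (.inl hby) e (e ▸ hbs)
    rcases hb' with hb' | rfl
    · exact hb' this.symm
    · exact hbs h.source
  constructor
  · rw [Function.update_of_ne hys.symm, h.source]
  · rw [Function.update_of_ne hyt.symm, h.sink]
  · intro a ha
    by_cases e : a = y
    · simpa [e] using h.lt w hw
    · simpa [Function.update_of_ne e] using h.lt a ha
  · intro a ha ha' b hb hb' e hs
    by_cases ea : a = y <;> by_cases eb : b = y
    · rw [ea, eb]
    · subst ea
      simp only [Function.update_self, Function.update_of_ne eb] at e hs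
      exact (key b hb eb hb' e (e ▸ hs)).elim
    · subst eb
      simp only [Function.update_self, Function.update_of_ne ea] at e hs
      exact (key a ha ea ha' e.symm hs).elim
    · simp only [Function.update_of_ne ea, Function.update_of_ne eb] at e hs
      exact h.inj a ha (.inl ea) b hb (.inl eb) e hs
  · intro a ha _
    by_cases e : a = y
    · simpa [e] using hA
    · simpa [Function.update_of_ne e] using h.step a ha (.inl e)
  · intro x hx hx'
    refine h.last x hx fun a ha ha' => ?_
    have hay : a ≠ y := by omega
    by_cases e : a = w
    · simpa [e] using hx' y hy (.inl hwy.symm)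
    · simpa [Function.update_of_ne hay] using hx' a ha (.inl e)

end PartialLinkage

/-- The nodes below `n` that are not values of `p`. -/
def missing (n : ℕ) (p : ℕ → ℕ) : Finset ℕ := {x ∈ Finset.range n | ∀ a < n, p a ≠ x}

namespace RAMProgram

/-- Augment the present flow along the path found by the search. -/
def augment : RAMProgram := .loop 13 (block
  [.add 12 6 13, .load 12 12, .add 11 7 13, .load 13 11, .add 11 6 13, .load 11 11, .load 11 11,
    .store 12 11])

/-- Following parents moves the hole from `queue h` to `queue 0 = s`. Parents have smaller indices,
so the predecessors still to be read are the original ones. The node `pred (queue h)` leaves the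
range of `pred` and nothing enters it, hence `missing` grows strictly. -/
theorem wp_augment {Q : RAMState → ℕ → Prop} {n s t : ℕ} {r m : ℕ → ℕ} {g : FlowArrays}
    {h l : ℕ} (hr : FlowRegisters n s t r) (hg : g.Stored n m) (h13 : r 13 = h)
    (hq : SearchQueue n s t g l) (hl : h < l) (ht : g.adj (g.pred (g.queue h)) t ≠ 0)
    (hp : PartialLinkage n s t g.adj g.pred s) (hst : g.adj s t = 0)
    (hQ : ∀ r' m' k p, k ≤ 10 * n + 1 → FlowRegisters n s t r' →
      ({g with pred := p} : FlowArrays).Stored n m' → r' 15 = r 15 →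
      PartialLinkage n s t g.adj p s → (missing n g.pred).card < (missing n p).card →
      Q ⟨r', m'⟩ k) :
    wp augment Q ⟨r, m⟩ := by
  have hln := hq.le_dim
  refine wp_loop (fun i r' m' => FlowRegisters n s t r' ∧ r' 13 = i ∧ r' 15 = r 15 ∧ i ≤ h ∧
    ∃ p, ({g with pred := p} : FlowArrays).Stored n m' ∧
      PartialLinkage n s t g.adj p (g.queue i) ∧
      (∀ j ≤ i, p (g.queue j) = g.pred (g.queue j)) ∧
      ∀ x ∈ insert (g.pred (g.queue h)) (missing n g.pred), ∀ a < n, (a ≠ g.queue i ∨ a = s) →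
        p a ≠ x) 9 ?_ h ?_ ?_
  · rintro i r m ⟨hr, h13, h15, hih, p, hg, hp, hpe, hx⟩ hi0
    rw [h13] at hi0
    have hil : i < l := by omega
    obtain ⟨hj, hA⟩ := hq.parent i hil (by omega)
    have hjl := hj.trans hil
    have e1 := hg.queue i (by omega)
    have e2 := hg.parent i (by omega)
    have e3 := hg.queue (g.parent i) (by omega)
    have e4 := hg.pred (g.queue (g.parent i)) (hq.lt _ hjl)
    have hne : ∀ j < i, g.queue j ≠ g.queue i := fun j hj e =>
      hj.ne (hq.inj j (by omega) i hil e)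
    have his : g.queue i ≠ s := fun e => hne 0 (by omega) (by rw [hq.first, e])
    simp only at e1 e2 e3 e4
    simp only [wp_block_cons, wp_block_nil, wp_const, wp_add, wp_sub, wp_load, wp_store, wp_ite,
      wp_skip, Function.update_self, Function.update_of_ne, ne_eq, Nat.reduceEqDiff,
      not_false_eq_true]
    simp only [h13, hr.queue, hr.parent, e1, e2, e3, e4]
    refine ⟨by norm_num, g.parent i, hj, ?_, rfl, h15, by omega, _,
      hg.store_pred (hq.lt i hil), ?_, ?_, ?_⟩
    · exact (((hr.update (by norm_num) _).update (by norm_num) _).update (by norm_num) _).update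
        (by norm_num) _ |>.update (by norm_num) _ |>.update (by norm_num) _ |>.update
        (by norm_num) _
    · exact hp.shift (hq.lt i hil) (hq.lt _ hjl) (hne _ hj) his (hq.ne_sink i hil)
        (by rw [hpe _ hj.le]; exact hA)
    · intro k hk
      simpa [Function.update_of_ne (hne k (by omega))] using hpe k (by omega)
    · intro x hx' a ha ha'
      by_cases e : a = g.queue i
      · simpa [e] using hx x hx' _ (hq.lt _ hjl) (.inl (hne _ hj))
      · simpa [Function.update_of_ne e] using hx x hx' a ha (.inl e)
  · refine ⟨hr, h13, rfl, le_rfl, g.pred, hg, hp.extend ht, fun _ _ => rfl, ?_⟩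
    intro x hx a ha ha' e
    rcases Finset.mem_insert.1 hx with rfl | hx
    · have hs : g.pred (g.queue h) ≠ s := fun e => ht (by rw [e, hst])
      have := hp.inj a ha (by omega) _ (hq.lt h hl) (by omega) e (e ▸ hs)
      rcases ha' with ha' | rfl
      · exact ha' this
      · exact hs (by rw [← e, hp.source])
    · exact (Finset.mem_filter.1 hx).2 a ha e
  · rintro i r' m' k hk hi ⟨hr, h13, h15, hih, p, hg, hp', hpe, hx⟩
    obtain rfl : i = 0 := by omega
    rw [hq.first] at hp' hx
    refine hQ _ _ _ p (by omega) hr hg h15 hp' (Finset.card_lt_card ?_)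
    have hsub : insert (g.pred (g.queue h)) (missing n g.pred) ⊆ missing n p := fun x hx' =>
      Finset.mem_filter.2 ⟨?_, fun a ha => hx x hx' a ha (by omega)⟩
    · refine (Finset.ssubset_insert fun hmem => ?_).trans_subset hsub
      exact (Finset.mem_filter.1 hmem).2 _ (hq.lt h hl) rfl
    · rcases Finset.mem_insert.1 hx' with rfl | hx'
      · exact Finset.mem_range.2 (hp.lt _ (hq.lt h hl))
      · exact (Finset.mem_filter.1 hx').1

/-! ### Iterated augmentation and output -/

/-- Augment the present flow as long as possible. -/
def augmentAll : RAMProgram := block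
  [.const 15 1, .loop 15 (block [search, .ite 15 augment .skip])]

theorem wp_augmentAll {Q : RAMState → ℕ → Prop} {n s t : ℕ} {r m : ℕ → ℕ} {g : FlowArrays}
    (hr : FlowRegisters n s t r) (hg : g.Stored n m) (hs : s < n) (ht : t < n) (hst : s ≠ t)
    (hA : g.adj s t = 0) (hrow : ∀ y < n, g.row y = n + n * y)
    (hp : PartialLinkage n s t g.adj g.pred s)
    (hQ : ∀ r' m' k g' l, k ≤ 200 * (n * n * n) → FlowRegisters n s t r' →
      g'.Stored n m' → g'.adj = g.adj → g'.out = g.out → (∀ y < n, g'.row y = n + n * y) →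
      PartialLinkage n s t g.adj g'.pred s → SearchQueue n s t g' l → g'.Scanned n t l →
      Q ⟨r', m'⟩ k) :
    wp augmentAll Q ⟨r, m⟩ := by
  simp only [augmentAll]
  simp only [wp_block_cons, wp_block_nil, wp_const, wp_add, wp_sub, wp_load, wp_store, wp_ite,
    wp_skip, Function.update_self, Function.update_of_ne, ne_eq, Nat.reduceEqDiff,
    not_false_eq_true]
  have hcard : ∀ p, (missing n p).card ≤ n := fun p =>
    (Finset.card_filter_le _ _).trans_eq (Finset.card_range n)
  have hn : n ≤ n * n := Nat.le_mul_self n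
  -- Every success enlarges `missing`, which has at most `n` elements; the extra 1 pays for the
  -- final failing search.
  refine wp_loop (fun i r' m' => FlowRegisters n s t r' ∧ ∃ g' : FlowArrays, g'.Stored n m' ∧
    g'.adj = g.adj ∧ g'.out = g.out ∧ (∀ y < n, g'.row y = n + n * y) ∧
    PartialLinkage n s t g.adj g'.pred s ∧
    (r' 15 ≠ 0 ∧ i + (missing n g'.pred).card = n + 1 ∨
      r' 15 = 0 ∧ ∃ l, SearchQueue n s t g' l ∧ g'.Scanned n t l)) (46 * (n * n) + 10 * n + 30)
    ?_ (n + 1 - (missing n g.pred).card) ?_ ?_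
  · rintro i r m ⟨hr, g', hg, hadj, hout, hrow, hp, hc⟩ h15
    replace hc := (hc.resolve_right fun h => h15 h.1).2
    have hci := hcard g'.pred
    rw [wp_block_cons]
    refine wp_search hr hg hs ht hst hrow hp.lt ?_
    intro r m k mark queue parent h l hk hr hg h13 hq hd
    simp only [wp_block_cons, wp_block_nil, wp_const, wp_add, wp_sub, wp_load, wp_store, wp_ite,
      wp_skip, Function.update_self, Function.update_of_ne, ne_eq, Nat.reduceEqDiff,
      not_false_eq_true]
    rcases hd with ⟨h15, hsc⟩ | ⟨h15, hhl, hht⟩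
    · refine ⟨fun h => absurd h15 h, fun _ => ⟨by omega, 0, by omega, hr, _, hg, hadj, hout, hrow,
        hp, .inr ⟨h15, l, hq, hsc⟩⟩⟩
    · refine ⟨fun _ => ?_, fun h => by omega⟩
      refine wp_augment hr hg h13 hq hhl hht (by simpa only [hadj] using hp)
        (by simpa only [hadj] using hA) ?_
      intro r' m' k' p hk' hr hg h15' hp hlt
      have := hcard p
      simp only [hadj] at hp hlt
      exact ⟨by omega, n + 1 - (missing n p).card, by omega, hr, _, hg, hadj, hout, hrow, hp,
        .inl ⟨by simp [h15', h15], Nat.sub_add_cancel (this.trans n.le_succ)⟩⟩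
  · have := hcard g.pred
    exact ⟨hr.update (by norm_num) _, g, hg, rfl, rfl, hrow, hp,
      .inl ⟨by simp, Nat.sub_add_cancel (by omega)⟩⟩
  · rintro i r' m' k hk h15 ⟨hr, g', hg, hadj, hout, hrow, hp, hc⟩
    have h2 : 2 ≤ n := by omega
    have h3 : n * n * 2 ≤ n * n * n := Nat.mul_le_mul_left _ h2
    have h4 : (n + 1 - (missing n g.pred).card) * (46 * (n * n) + 10 * n + 30 + 1) ≤
        (n + 1) * (46 * (n * n) + 10 * n + 30 + 1) := Nat.mul_le_mul_right _ (by omega)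
    have h5 : (n + 1) * (46 * (n * n) + 10 * n + 30 + 1) =
        46 * (n * n * n) + 56 * (n * n) + 41 * n + 31 := by ring
    have h6 : n * 2 ≤ n * n := Nat.mul_le_mul_left _ h2
    obtain ⟨-, l, hq, hsc⟩ := hc.resolve_left fun h => h.1 h15
    exact hQ _ _ _ g' l (by omega) hr hg hadj hout hrow hp hq hsc

/-- Write the present flow into the output area, and its size into the register `0`. -/
def writeFlow : RAMProgram := block
  [clearMarks, .const 19 0, .add 10 0 4,
    .loop 10 (block [.sub 10 10 3, .load 11 10, .add 12 5 11, .store 12 3, .sub 12 11 10,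
      .sub 16 10 11, .add 12 12 16,
      .ite 12
        (block [.add 12 8 11, .load 12 12, .add 12 12 9, .add 12 12 10, .store 12 3, .sub 12 11 1,
          .sub 16 1 11, .add 12 12 16, .ite 12 .skip (.add 19 19 3)])
        .skip]),
    .add 10 0 4,
    .loop 10 (block [.sub 10 10 3, .add 12 5 10, .load 12 12,
      .ite 12 .skip
        (block [.add 12 8 10, .load 12 12, .add 12 12 9, .add 12 12 2, .store 12 3])]),
    .add 0 19 4]

/-- The first pass writes the edges given by `pred`, counts those leaving `s`, and marks the range
of `pred`; the second adds an edge to `t` from every unmarked node. Inequality of x and y is tested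
by (x - y) + (y - x) ≠ 0 in truncated subtraction. -/
theorem wp_writeFlow {Q : RAMState → ℕ → Prop} {n s t : ℕ} {r m : ℕ → ℕ} {g : FlowArrays}
    (hr : FlowRegisters n s t r) (hg : g.Stored n m) (ht : t < n)
    (hrow : ∀ y < n, g.row y = n + n * y) (hpred : ∀ y < n, g.pred y < n)
    (hout : ∀ i < n, ∀ j < n, g.out i j = 0)
    (hQ : ∀ r' m' k, k ≤ 50 * n + 20 →
      r' 0 = {y ∈ Finset.range n | g.pred y = s ∧ g.pred y ≠ y}.card →
      (∀ i < n, ∀ j < n, m' (n + n * n + n * i + j) =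
        if g.pred j = i ∧ i ≠ j ∨ j = t ∧ ∀ a < n, g.pred a ≠ i then 1 else 0) → Q ⟨r', m'⟩ k) :
    wp writeFlow Q ⟨r, m⟩ := by
  simp only [writeFlow]
  rw [wp_block_cons]
  refine wp_clearMarks hr hg fun r m k₀ mark hk₀ hr hg hm => ?_
  simp only [wp_block_cons, wp_block_nil, wp_const, wp_add, wp_sub, wp_load, wp_store, wp_ite,
    wp_skip, Function.update_self, Function.update_of_ne, ne_eq, Nat.reduceEqDiff,
    not_false_eq_true]
  -- An output row lies `n * n` cells after the corresponding row of the adjacency matrix.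
  have addr : ∀ x y, n + n * x + n * n + y = n + n * n + n * x + y := fun x y => by ring
  refine wp_countdown (fun i r' m' => FlowRegisters n s t r' ∧ r' 10 = i ∧
    r' 19 = {y ∈ Finset.range n | i ≤ y ∧ g.pred y = s ∧ g.pred y ≠ y}.card ∧
    ∃ mark out, ({g with mark := mark, out := out} : FlowArrays).Stored n m' ∧
      (∀ z < n, mark z ≠ 0 ↔ ∃ a < n, i ≤ a ∧ g.pred a = z) ∧
      ∀ a < n, ∀ b < n, out a b = if i ≤ b ∧ g.pred b = a ∧ a ≠ b then 1 else 0) 24 n ?_ ?_ ?_ ?_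
  · rintro i r m ⟨-, h, -⟩; exact h
  · rintro i hi r' m' ⟨hr, h10, h19, mark, out, hg, hm, ho⟩
    have hpn := hpred i hi
    have e1 := hg.pred i hi
    have hg1 := hg.store_mark (v := 1) hpn
    have e2 := hg1.row _ hpn
    simp only [hrow _ hpn] at e1 e2
    simp only [wp_block_cons, wp_block_nil, wp_const, wp_add, wp_sub, wp_load, wp_store, wp_ite,
      wp_skip, Function.update_self, Function.update_of_ne, ne_eq, Nat.reduceEqDiff,
      not_false_eq_true]
    simp only [h10, h19, hr.one, hr.mark, hr.row, hr.source, hr.square, Nat.add_sub_cancel, e1, e2,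
      addr]
    have hmark : ∀ z < n, Function.update mark (g.pred i) 1 z ≠ 0 ↔
        ∃ a < n, i ≤ a ∧ g.pred a = z := by
      intro z hz
      by_cases e : z = g.pred i
      · simp only [e, Function.update_self]
        exact ⟨fun _ => ⟨i, hi, le_rfl, rfl⟩, fun _ => one_ne_zero⟩
      · rw [Function.update_of_ne e, hm z hz]
        constructor
        · rintro ⟨a, ha, hia, h⟩; exact ⟨a, ha, by omega, h⟩
        · rintro ⟨a, ha, hia, h⟩
          refine ⟨a, ha, ?_, h⟩
          rcases hia.eq_or_lt with rfl | hia
          · exact absurd h.symm e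
          · exact hia
    have hsucc : ∀ b P, (i ≤ b ∧ P ↔ i + 1 ≤ b ∧ P ∨ b = i ∧ P) := by
      intro b P
      constructor
      · rintro ⟨h1, h2⟩
        rcases h1.eq_or_lt with rfl | h1
        · exact .inr ⟨rfl, h2⟩
        · exact .inl ⟨h1, h2⟩
      · rintro (⟨h1, h2⟩ | ⟨rfl, h2⟩)
        · exact ⟨by omega, h2⟩
        · exact ⟨le_rfl, h2⟩
    have hnocount : ¬ (g.pred i = s ∧ g.pred i ≠ i) →
        {y ∈ Finset.range n | i + 1 ≤ y ∧ g.pred y = s ∧ g.pred y ≠ y}.card =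
        {y ∈ Finset.range n | i ≤ y ∧ g.pred y = s ∧ g.pred y ≠ y}.card := by
      intro h
      congr 1
      refine Finset.filter_congr fun y _ => ?_
      rw [hsucc y]
      refine (or_iff_left ?_).symm
      rintro ⟨rfl, h'⟩
      exact h h'
    have hcount : (g.pred i = s ∧ g.pred i ≠ i) →
        {y ∈ Finset.range n | i + 1 ≤ y ∧ g.pred y = s ∧ g.pred y ≠ y}.card + 1 =
        {y ∈ Finset.range n | i ≤ y ∧ g.pred y = s ∧ g.pred y ≠ y}.card := by
      intro h
      rw [← Finset.card_insert_of_notMem (a := i) (by simp)]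
      congr 1
      ext y
      simp only [Finset.mem_insert, Finset.mem_filter, Finset.mem_range]
      rw [hsucc y]
      constructor
      · rintro (rfl | h')
        · exact ⟨hi, .inr ⟨rfl, h⟩⟩
        · exact ⟨h'.1, .inl h'.2⟩
      · rintro ⟨h1, h2 | h2⟩
        · exact .inr ⟨h1, h2⟩
        · exact .inl h2.1
    have hout : g.pred i ≠ i → ∀ a < n, ∀ b < n,
        (if a = g.pred i ∧ b = i then 1 else out a b) =
          if i ≤ b ∧ g.pred b = a ∧ a ≠ b then 1 else 0 := by
      intro h a ha b hb
      rw [ho a ha b hb]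
      simp only [hsucc b]
      by_cases e : a = g.pred i ∧ b = i
      · obtain ⟨rfl, rfl⟩ := e
        simp [h]
      · have : ¬ (b = i ∧ g.pred b = a ∧ a ≠ b) := by
          rintro ⟨rfl, rfl, -⟩; exact e ⟨rfl, rfl⟩
        simp only [e, this, if_false, or_false]
    refine ⟨fun hne => ⟨fun hs => ?_, fun hs => ?_⟩, fun heq => ?_⟩
    · refine ⟨by norm_num, ?_, trivial, hnocount (by omega), _, _, hg1.store_out hpn hi, hmark,
        hout (by omega)⟩
      repeat' (refine FlowRegisters.update ?_ (by norm_num) _)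
      exact hr
    · refine ⟨by norm_num, ?_, trivial, hcount (by omega), _, _, hg1.store_out hpn hi, hmark,
        hout (by omega)⟩
      repeat' (refine FlowRegisters.update ?_ (by norm_num) _)
      exact hr
    · refine ⟨by norm_num, ?_, trivial, hnocount (by omega), _, out, hg1, hmark, ?_⟩
      · repeat' (refine FlowRegisters.update ?_ (by norm_num) _)
        exact hr
      · intro a ha b hb
        rw [ho a ha b hb]
        simp only [hsucc b]
        have : ¬ (b = i ∧ g.pred b = a ∧ a ≠ b) := by
          rintro ⟨rfl, rfl, h⟩
          omega
        simp only [this, or_false]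
  · refine ⟨?_, ?_, ?_, mark, g.out, hg, ?_, ?_⟩
    · exact (hr.update (by norm_num) _).update (by norm_num) _
    · simp [hr.dim, hr.zero]
    · rw [Finset.filter_false_of_mem]
      · simp
      · intro y hy
        have := Finset.mem_range.1 hy
        omega
    · intro z hz
      refine ⟨fun h => absurd (hm z hz) h, ?_⟩
      rintro ⟨a, ha, ha', -⟩
      omega
    · intro a ha b hb
      rw [if_neg (by omega)]
      exact hout a ha b hb
  · rintro r m k₁ hk₁ ⟨hr, -, h19, mark, out, hg, hm, ho⟩
    simp only [wp_block_cons, wp_block_nil, wp_const, wp_add, wp_sub, wp_load, wp_store, wp_ite,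
      wp_skip, Function.update_self, Function.update_of_ne, ne_eq, Nat.reduceEqDiff,
      not_false_eq_true]
    refine wp_countdown (fun i r' m' => FlowRegisters n s t r' ∧ r' 10 = i ∧ r' 19 = r 19 ∧
      ∃ out, ({g with mark := mark, out := out} : FlowArrays).Stored n m' ∧
        ∀ a < n, ∀ b < n, out a b = if g.pred b = a ∧ a ≠ b ∨ b = t ∧ i ≤ a ∧ mark a = 0
          then 1 else 0) 12 n ?_ ?_ ?_ ?_
    · rintro i r m ⟨-, h, -⟩; exact h
    · rintro i hi r' m' ⟨hr, h10, h19, out, hg, ho⟩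
      have e1 := hg.mark i hi
      have e2 := hg.row i hi
      simp only [hrow _ hi] at e1 e2
      simp only [wp_block_cons, wp_block_nil, wp_const, wp_add, wp_sub, wp_load, wp_store, wp_ite,
        wp_skip, Function.update_self, Function.update_of_ne, ne_eq, Nat.reduceEqDiff,
        not_false_eq_true]
      simp only [h10, hr.one, hr.mark, hr.row, hr.sink, hr.square, Nat.add_sub_cancel, e1, e2,
        addr]
      refine ⟨fun hne => ?_, fun he => ?_⟩
      · refine ⟨by norm_num, ?_, trivial, h19, out, hg, ?_⟩
        · repeat' (refine FlowRegisters.update ?_ (by norm_num) _)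
          exact hr
        · intro a ha b hb
          rw [ho a ha b hb]
          refine if_congr (or_congr_right ⟨?_, ?_⟩) rfl rfl
          · rintro ⟨h1, h2, h3⟩; exact ⟨h1, by omega, h3⟩
          · rintro ⟨h1, h2, h3⟩
            refine ⟨h1, ?_, h3⟩
            rcases h2.eq_or_lt with rfl | h2
            · exact absurd h3 hne
            · exact h2
      · refine ⟨by norm_num, ?_, trivial, h19, _, hg.store_out hi ht, ?_⟩
        · repeat' (refine FlowRegisters.update ?_ (by norm_num) _)
          exact hr
        · intro a ha b hb
          by_cases e : a = i ∧ b = t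
          · obtain ⟨rfl, rfl⟩ := e
            simp [he]
          · rw [if_neg e]
            refine (ho a ha b hb).trans ?_
            refine if_congr (or_congr_right ⟨?_, ?_⟩) rfl rfl
            · rintro ⟨h1, h2, h3⟩; exact ⟨h1, by omega, h3⟩
            · rintro ⟨h1, h2, h3⟩; exact ⟨h1, by omega, h3⟩
    · refine ⟨hr.update (by norm_num) _, by simp [hr.dim, hr.zero], by simp, out, hg, ?_⟩
      intro a ha b hb
      rw [ho a ha b hb]
      exact if_congr (by omega) rfl rfl
    · rintro r' m' k hk ⟨hr', -, h19', out, hg, ho⟩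
      simp only [wp_block_cons, wp_block_nil, wp_const, wp_add, wp_sub, wp_load, wp_store, wp_ite,
        wp_skip, Function.update_self, Function.update_of_ne, ne_eq, Nat.reduceEqDiff,
        not_false_eq_true]
      refine hQ _ _ _ (by omega) ?_ ?_
      · simp [hr'.zero, h19', h19]
      · intro i hi j hj
        refine ((hg.out i hi j hj).trans (ho i hi j hj)).trans (if_congr (or_congr_right ?_) rfl rfl)
        have := hm i hi
        simp only [Nat.zero_le, true_and, ne_eq] at this ⊢
        rw [not_iff_comm] at this
        rw [← this]
        push Not
        rfl

end RAMProgram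

/-! ### Linkages, barriers and cuts -/

namespace FlowNetwork

variable {N : Type u} (F : FlowNetwork N)

/-- Vertex-disjoint paths from the source to the sink (and cycles), given by the predecessor `p a`
of each node `a`, where `p a = a` if `a` is not used. -/
structure Linkage (p : N → N) : Prop where
  source : p F.source = F.source
  sink : p F.sink = F.sink
  inj : ∀ a b, p a = p b → p a ≠ F.source → a = b
  step : ∀ a, p a = a ∨ F.edge (p a) a
  last : ∀ x, (∀ a, p a ≠ x) → F.edge x F.sink

/-- `W` is a set of nodes that contains the source and that a search for an augmentation of the
linkage `p` does not leave. -/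
structure IsBarrier (p : N → N) (W : Finset N) : Prop where
  source_mem : F.source ∈ W
  sink_notMem : F.sink ∉ W
  not_edge : ∀ a ∈ W, ¬ F.edge (p a) F.sink
  closed : ∀ a ∈ W, ∀ z, p a = z ∨ F.edge (p a) z → z ∈ W

/-- A set `K` of nodes separates the source from the sink, where `X` is the source side. -/
structure IsCut (X K : Finset N) : Prop where
  source_mem : F.source ∈ X
  source_notMem : F.source ∉ K
  sink_notMem : F.sink ∉ X
  sink_notMem' : F.sink ∉ K
  closed : ∀ x ∈ X, ∀ z, F.edge x z → z ∈ X ∨ z ∈ K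

/-- Infinite edge capacities, unit capacities of the inner nodes, and no edge into the source or
from the source to the sink. -/
structure IsUnit : Prop where
  edgeCap : ∀ x y, F.edgeCap x y = ⊤
  nodeCap : ∀ x, x ≠ F.source → x ≠ F.sink → F.nodeCap x = 1
  source_ne_sink : F.source ≠ F.sink
  not_edge : ¬ F.edge F.source F.sink
  not_edge_source : ∀ x, ¬ F.edge x F.source

open Classical in
/-- The number of paths of a linkage. -/
noncomputable def linkageSize [Fintype N] (p : N → N) : ℕ :=
  {y : N | p y = F.source ∧ p y ≠ y}.toFinset.card

open Classical in
/-- The flow along the paths and cycles of a linkage. -/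
noncomputable def linkageFlow (p : N → N) (x y : N) : ℝ≥0 :=
  if p y = x ∧ x ≠ y ∨ y = F.sink ∧ ∀ a, p a ≠ x then 1 else 0

variable {F} {p : N → N}

theorem linkageFlow_eq_ite {x y : N} {P : Prop} [Decidable P]
    (h : p y = x ∧ x ≠ y ∨ y = F.sink ∧ (∀ a, p a ≠ x) ↔ P) :
    F.linkageFlow p x y = if P then 1 else 0 := by
  unfold linkageFlow
  by_cases hP : P
  · rw [if_pos hP, if_pos (h.2 hP)]
  · rw [if_neg hP, if_neg (mt h.1 hP)]

/-- An inner node with `p x = x` has no other successor by injectivity. Any other inner node has one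
predecessor, and one successor: the unique `a` with `p a = x`, or the sink if there is none. -/
theorem Linkage.isFlow [Fintype N] (hF : F.IsUnit) (h : F.Linkage p) :
    F.IsFlow (F.linkageFlow p) := by
  classical
  refine ⟨fun x y hxy => if_neg ?_, fun x hs ht => ?_, fun x y _ => by simp [hF.edgeCap]⟩
  · rintro (⟨rfl, hne⟩ | ⟨rfl, hx⟩)
    · exact hxy ((h.step y).resolve_left hne)
    · exact hxy (h.last x hx)
  · have hin : ∑ y, F.linkageFlow p y x = if p x = x then 0 else 1 := by
      have : ∀ y, F.linkageFlow p y x = if y = p x then (if p x = x then 0 else 1) else 0 := by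
        intro y
        unfold linkageFlow
        by_cases e : y = p x
        · subst e; simp [ht]
        · simp [ht, e, Ne.symm e]
      simp [this]
    have hout : ∑ y, F.linkageFlow p x y = if p x = x then 0 else 1 := by
      by_cases hx : p x = x
      · rw [if_pos hx]
        refine Finset.sum_eq_zero fun y _ => if_neg ?_
        rintro (⟨e, hne⟩ | ⟨-, hx'⟩)
        · exact hne (h.inj x y (hx.trans e.symm) (by rwa [hx]))
        · exact hx' x hx
      · rw [if_neg hx]
        by_cases him : ∃ a, p a = x
        · obtain ⟨a, ha⟩ := him
          have : ∀ y, F.linkageFlow p x y = if y = a then 1 else 0 := by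
            intro y
            refine linkageFlow_eq_ite ⟨?_, ?_⟩
            · rintro (⟨e, -⟩ | ⟨-, hx'⟩)
              · exact h.inj y a (e.trans ha.symm) (e ▸ hs)
              · exact absurd ha (hx' a)
            · rintro rfl
              exact .inl ⟨ha, fun e => hx (by rwa [← e] at ha)⟩
          simp [this]
        · push Not at him
          have : ∀ y, F.linkageFlow p x y = if y = F.sink then 1 else 0 := by
            intro y
            refine linkageFlow_eq_ite ⟨?_, ?_⟩
            · rintro (⟨e, -⟩ | ⟨e, -⟩)
              · exact absurd e (him y)
              · exact e
            · exact fun e => .inr ⟨e, him⟩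
          simp [this]
    rw [hin, hout, hF.nodeCap x hs ht]
    refine ⟨rfl, ?_⟩
    split_ifs <;> simp

theorem Linkage.size_linkageFlow [Fintype N] (h : F.Linkage p) :
    F.size (F.linkageFlow p) = F.linkageSize p := by
  classical
  have : ∀ y, F.linkageFlow p F.source y = if p y = F.source ∧ p y ≠ y then 1 else 0 := by
    intro y
    refine linkageFlow_eq_ite ⟨?_, ?_⟩
    · rintro (⟨e, hne⟩ | ⟨-, h'⟩)
      · exact ⟨e, e ▸ hne⟩
      · exact absurd h.source (h' _)
    · rintro ⟨e, hne⟩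
      exact .inl ⟨e, e ▸ hne⟩
  simp [size, linkageSize, this]

/-- Sum conservation over `X`: the size plus the inflow of `X` equals its outflow, which is at most
the flow inside `X` plus the flow into `K`. The inner flow is part of the inflow and cancels, and
each node of `K` admits at most one unit. -/
theorem IsCut.size_le [Fintype N] (hF : F.IsUnit) {X K : Finset N} (hc : F.IsCut X K)
    {f : N → N → ℝ≥0} (hf : F.IsFlow f) : F.size f ≤ K.card := by
  classical
  have h1 : F.size f + ∑ x ∈ X.erase F.source, ∑ y, f x y = ∑ x ∈ X, ∑ y, f x y :=
    Finset.add_sum_erase X (fun x => ∑ y, f x y) hc.source_mem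
  have h2 : ∑ x ∈ X.erase F.source, ∑ y, f x y = ∑ x ∈ X, ∑ y, f y x := by
    rw [← Finset.add_sum_erase X (fun x => ∑ y, f y x) hc.source_mem]
    have : ∑ y, f y F.source = 0 :=
      Finset.sum_eq_zero fun y _ => hf.1 _ _ (hF.not_edge_source y)
    rw [this, zero_add]
    refine Finset.sum_congr rfl fun x hx => ?_
    obtain ⟨hxs, hxX⟩ := Finset.mem_erase.1 hx
    exact ((hf.2.1 x hxs fun e => hc.sink_notMem (e ▸ hxX)).1).symm
  have h3 : ∑ x ∈ X, ∑ y ∈ X, f y x ≤ ∑ x ∈ X, ∑ y, f y x :=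
    Finset.sum_le_sum fun x _ => Finset.sum_le_sum_of_subset (Finset.subset_univ _)
  have h4 : ∑ x ∈ X, ∑ y, f x y ≤ ∑ x ∈ X, ∑ y ∈ X, f x y + ∑ x ∈ X, ∑ y ∈ K, f x y := by
    rw [← Finset.sum_add_distrib]
    refine Finset.sum_le_sum fun x hx => ?_
    calc ∑ y, f x y = ∑ y ∈ X ∪ K, f x y := by
          refine (Finset.sum_subset (Finset.subset_univ _) fun z _ hz => hf.1 _ _ fun he => hz ?_).symm
          exact Finset.mem_union.2 (hc.closed x hx z he)
      _ ≤ _ := by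
          rw [← Finset.sum_union_inter]
          exact le_self_add
  have h5 : ∑ x ∈ X, ∑ y ∈ K, f x y ≤ K.card := by
    rw [Finset.sum_comm]
    refine (Finset.sum_le_card_nsmul K _ 1 fun z hz => ?_).trans_eq (by simp)
    have hzs : z ≠ F.source := fun e => hc.source_notMem (e ▸ hz)
    have hzt : z ≠ F.sink := fun e => hc.sink_notMem' (e ▸ hz)
    obtain ⟨h6, h7⟩ := hf.2.1 z hzs hzt
    rw [hF.nodeCap z hzs hzt, ← h6] at h7
    exact (Finset.sum_le_sum_of_subset (Finset.subset_univ _)).trans (by exact_mod_cast h7)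
  rw [Finset.sum_comm] at h3
  have h6 : F.size f + ∑ x ∈ X, ∑ y, f y x ≤ K.card + ∑ x ∈ X, ∑ y, f y x := by
    rw [← h2, h1, h2]
    refine h4.trans ?_
    rw [add_comm]
    exact add_le_add h5 h3
  exact le_of_add_le_add_right h6

/-- Take `X = p(W)` and `K = W \ p(W)`. Closedness puts all first nodes of paths into `W`, so the
fibre over the source in `W` has one element more than there are paths. Off this fibre `p` is
injective, so |W| - |p(W)| is the number of paths. -/
theorem Linkage.exists_isCut [Fintype N] (h : F.Linkage p) {W : Finset N}
    (hW : F.IsBarrier p W) : ∃ X K : Finset N, F.IsCut X K ∧ K.card = F.linkageSize p := by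
  classical
  have hXW : W.image p ⊆ W := by
    intro x hx
    obtain ⟨a, ha, rfl⟩ := Finset.mem_image.1 hx
    exact hW.closed a ha _ (.inl rfl)
  have hsX : F.source ∈ W.image p := Finset.mem_image.2 ⟨_, hW.source_mem, h.source⟩
  refine ⟨W.image p, W \ W.image p, ⟨hsX, fun hs => (Finset.mem_sdiff.1 hs).2 hsX,
    fun ht => hW.sink_notMem (hXW ht), fun ht => hW.sink_notMem (Finset.mem_sdiff.1 ht).1,
    fun x hx z hxz => ?_⟩, ?_⟩
  · obtain ⟨a, ha, rfl⟩ := Finset.mem_image.1 hx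
    by_cases hz : z ∈ W.image p
    · exact .inl hz
    · exact .inr (Finset.mem_sdiff.2 ⟨hW.closed a ha z (.inr hxz), hz⟩)
  · have h1 := Finset.card_filter_add_card_filter_not (s := W) (fun y => p y = F.source)
    have h2 : ((W.image p).erase F.source).card = {y ∈ W | ¬ p y = F.source}.card := by
      rw [← Finset.card_image_of_injOn (s := {y ∈ W | ¬ p y = F.source}) (f := p)]
      · congr 1
        ext x
        simp only [Finset.mem_erase, Finset.mem_image, Finset.mem_filter]
        constructor
        · rintro ⟨hx, a, ha, rfl⟩
          exact ⟨a, ⟨ha, hx⟩, rfl⟩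
        · rintro ⟨a, ⟨ha, hx⟩, rfl⟩
          exact ⟨hx, a, ha, rfl⟩
      · intro a ha b hb e
        exact h.inj a b e (Finset.mem_filter.1 ha).2
    have h3 : {y ∈ W | p y = F.source} =
        insert F.source {y : N | p y = F.source ∧ p y ≠ y}.toFinset := by
      ext y
      simp only [Finset.mem_filter, Finset.mem_insert, Set.mem_toFinset, Set.mem_ofPred_eq]
      constructor
      · rintro ⟨-, hy⟩
        by_cases e : y = F.source
        · exact .inl e
        · exact .inr ⟨hy, by rw [hy]; exact Ne.symm e⟩
      · rintro (rfl | ⟨hy, hne⟩)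
        · exact ⟨hW.source_mem, h.source⟩
        · refine ⟨hW.closed F.source hW.source_mem y (.inr ?_), hy⟩
          rw [h.source, ← hy]
          exact (h.step y).resolve_left hne
    have h4 : F.source ∉ {y : N | p y = F.source ∧ p y ≠ y}.toFinset := by
      simp [h.source]
    rw [h3, Finset.card_insert_of_notMem h4] at h1
    rw [Finset.card_erase_of_mem hsX] at h2
    have h5 := Finset.card_pos.2 ⟨_, hsX⟩
    rw [Finset.card_sdiff_of_subset hXW]
    unfold linkageSize
    omega

theorem Linkage.isMaxFlow [Fintype N] (hF : F.IsUnit) (h : F.Linkage p) {W : Finset N}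
    (hW : F.IsBarrier p W) : F.IsMaxFlow (F.linkageFlow p) := by
  obtain ⟨X, K, hc, hK⟩ := h.exists_isCut hW
  refine ⟨h.isFlow hF, fun f hf => ?_⟩
  rw [h.size_linkageFlow, ← hK]
  exact hc.size_le hF hf

/-- The same fibre count with all nodes in place of `W`: each path has exactly one end outside the
range of `p`. -/
theorem Linkage.card_missing [Fintype N] (h : F.Linkage p) :
    {x : N | ∀ a, p a ≠ x}.ncard = F.linkageSize p := by
  classical
  have h1 := Finset.card_filter_add_card_filter_not (s := (Finset.univ : Finset N))
    (fun y => p y = F.source)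
  have h2 := Finset.card_filter_add_card_filter_not (s := (Finset.univ : Finset N))
    (fun x => ∀ a, p a ≠ x)
  have hs : F.source ∈ Finset.univ.image p := Finset.mem_image.2 ⟨_, Finset.mem_univ _, h.source⟩
  have h3 : {x : N | ¬ ∀ a, p a ≠ x} = Finset.univ.image p := by
    ext x; simp
  have h4 : ((Finset.univ.image p).erase F.source).card =
      (Finset.univ.filter fun y => ¬ p y = F.source).card := by
    rw [← Finset.card_image_of_injOn (s := Finset.univ.filter fun y => ¬ p y = F.source) (f := p)]
    · congr 1
      ext x
      simp only [Finset.mem_erase, Finset.mem_image, Finset.mem_filter, Finset.mem_univ, true_and]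
      constructor
      · rintro ⟨hx, a, rfl⟩
        exact ⟨a, hx, rfl⟩
      · rintro ⟨a, hx, rfl⟩
        exact ⟨hx, a, rfl⟩
    · intro a ha b hb e
      exact h.inj a b e (Finset.mem_filter.1 ha).2
  have h5 : (Finset.univ.filter fun y => p y = F.source) =
      insert F.source {y : N | p y = F.source ∧ p y ≠ y}.toFinset := by
    ext y
    simp only [Finset.mem_filter, Finset.mem_insert, Set.mem_toFinset, Set.mem_ofPred_eq,
      Finset.mem_univ, true_and]
    constructor
    · intro hy
      by_cases e : y = F.source
      · exact .inl e
      · exact .inr ⟨hy, by rw [hy]; exact Ne.symm e⟩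
    · rintro (rfl | ⟨hy, hne⟩)
      · exact h.source
      · exact hy
  have h6 : F.source ∉ {y : N | p y = F.source ∧ p y ≠ y}.toFinset := by
    simp [h.source]
  have h7 : {x : N | ∀ a, p a ≠ x}.ncard = (Finset.univ.filter fun x => ∀ a, p a ≠ x).card := by
    rw [← Set.ncard_coe_finset]
    simp
  have h8 := Finset.card_pos.2 ⟨_, hs⟩
  rw [h5, Finset.card_insert_of_notMem h6] at h1
  rw [Finset.card_erase_of_mem hs] at h4
  rw [h7]
  have h9 : (Finset.univ.filter fun x => ¬ ∀ a, p a ≠ x).card = (Finset.univ.image p).card :=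
    congrArg _ (by ext x; simp)
  unfold linkageSize
  omega

end FlowNetwork

/-! ### From machine states to networks -/

namespace FlowNetwork

variable {N : Type u} (F : FlowNetwork N) {n : ℕ} (e : N ≃ Fin n)

theorem input_adj (x y : N) :
    (F.input e).mem (n + n * (e x) + e y) ≠ 0 ↔ F.edge x y := by
  have h1 : ¬ n + n * (e x : ℕ) + e y < n := by omega
  have h2 : n + n * (e x : ℕ) + e y - n = n * (e x) + e y := by omega
  have h3 : n * (e x : ℕ) + e y < n * n := mul_add_lt_mul_self (e x).2 (e y).2
  have h4 : ∀ a : Fin (n * n), (a : ℕ) = n * (e x : ℕ) + e y →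
      finProdFinEquiv.symm a = (e x, e y) := by
    intro a ha
    rw [Equiv.symm_apply_eq]
    ext
    simp [finProdFinEquiv, add_comm, ha]
  have h5 : n + n * (e x : ℕ) + e y - n < n * n := h2 ▸ h3
  simp only [input]
  rw [dif_neg h1, dif_pos h5, h4 ⟨_, h5⟩ h2]
  simp only [Equiv.symm_apply_apply]
  split_ifs with h <;> simpa using h

theorem input_out {i j : ℕ} :
    (F.input e).mem (n + n * n + n * i + j) = 0 := by
  have h1 : ¬ n + n * n + n * i + j < n := by omega
  have h2 : ¬ n + n * n + n * i + j - n < n * n := by omega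
  simp only [input, h1, dif_neg, not_false_eq_true, h2]

variable {F}

/-- A linkage on the numbers below `n` is a linkage on the nodes that they number. -/
theorem _root_.PartialLinkage.linkage {A : ℕ → ℕ → ℕ} {p : ℕ → ℕ}
    (hA : ∀ x y, A (e x) (e y) ≠ 0 ↔ x = y ∨ F.edge x y)
    (h : PartialLinkage n (e F.source) (e F.sink) A p (e F.source)) :
    F.Linkage fun x => e.symm ⟨p (e x), h.lt _ (e x).2⟩ := by
  have hval : ∀ x y, e.symm ⟨p (e x), h.lt _ (e x).2⟩ = y ↔ p (e x) = e y := by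
    intro x y
    rw [Equiv.symm_apply_eq, Fin.ext_iff]
  have hlive : ∀ a : ℕ, a ≠ e F.source ∨ a = e F.source := fun a => by omega
  have hsink : e.symm ⟨p (e F.sink), h.lt _ (e F.sink).2⟩ = F.sink := (hval _ _).2 h.sink
  refine ⟨(hval _ _).2 h.source, hsink, fun a b hab ha => ?_, fun a => ?_, fun x hx => ?_⟩
  · have := h.inj (e a) (e a).2 (hlive _) (e b) (e b).2 (hlive _)
      (by simpa [Fin.ext_iff] using hab) fun e' => ha ((hval _ _).2 e')
    exact e.injective (Fin.ext this)
  · have := h.step (e a) (e a).2 (hlive _)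
    refine (hA _ _).1 ?_
    simpa using this
  · have := h.last (e x) (e x).2 fun a ha _ e' =>
      hx (e.symm ⟨a, ha⟩) ((hval _ _).2 (by simpa using e'))
    exact ((hA _ _).1 this).resolve_left fun e' => hx F.sink (e' ▸ hsink)

end FlowNetwork

namespace RAMProgram

/-- Find a maximum flow in a network with unit node capacities. -/
def maxFlow : RAMProgram := block [setRegisters, initArrays, augmentAll, writeFlow]

/-- The barrier is the set of nodes in the queue of the last, failing search. The assertion speaks
of linkages instead of flows so that it also serves as an existence result. -/
theorem wp_maxFlow {N : Type u} [Fintype N] (F : FlowNetwork N) {n : ℕ} (e : N ≃ Fin n)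
    (hst : F.source ≠ F.sink) (hF : ¬ F.edge F.source F.sink) :
    wp maxFlow (fun σ k => k ≤ 400 * (n * n * n) ∧ ∃ p W, F.Linkage p ∧ F.IsBarrier p W ∧
      σ.reg 0 = F.linkageSize p ∧ ∀ i j : Fin n,
        (σ.mem (n + n * n + n * i + j) : ℝ≥0) = F.linkageFlow p (e.symm i) (e.symm j))
      (F.input e) := by
  classical
  have hs : (e F.source : ℕ) ≠ e F.sink := fun h => hst (e.injective (Fin.ext h))
  have hn : 2 ≤ n := by have := (e F.source).2; have := (e F.sink).2; omega
  have hn2 : n * 2 ≤ n * n := Nat.mul_le_mul_left _ hn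
  have hn3 : n * n * 2 ≤ n * n * n := Nat.mul_le_mul_left _ hn
  rw [maxFlow, wp_block_cons]
  refine wp_setRegisters (n := n) (s := e F.source) (t := e F.sink) (r := (F.input e).reg)
    (m := (F.input e).mem) rfl rfl rfl rfl rfl ?_
  intro r k₁ hk₁ hr
  rw [wp_block_cons]
  refine wp_initArrays hr ?_
  intro r m k₂ g hk₂ hr hg hpred hrow hadj hout
  replace hadj : ∀ x y, g.adj (e x) (e y) ≠ 0 ↔ x = y ∨ F.edge x y := by
    intro x y
    rw [hadj _ (e x).2 _ (e y).2, F.input_adj e, ← Fin.ext_iff, e.apply_eq_iff_eq]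
  have hp : PartialLinkage n (e F.source) (e F.sink) g.adj g.pred (e F.source) := by
    refine (PartialLinkage.id fun a ha => ?_).congr (e F.source).2 (e F.sink).2 hpred
    have := (hadj (e.symm ⟨a, ha⟩) (e.symm ⟨a, ha⟩)).2 (.inl rfl)
    simpa using this
  have hA : g.adj (e F.source) (e F.sink) = 0 := by
    by_contra h
    exact ((hadj _ _).1 h).elim hst hF
  rw [wp_block_cons]
  refine wp_augmentAll hr hg (e F.source).2 (e F.sink).2 hs hA hrow hp ?_
  intro r m k₃ g' l hk₃ hr hg hadj' hout' hrow hp hq hsc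
  rw [wp_block_cons]
  refine wp_writeFlow hr hg (e F.sink).2 hrow hp.lt ?_ ?_
  · intro i hi j hj
    rw [hout', hout i hi j hj, F.input_out e]
  intro r m k₄ hk₄ hr0 hm
  rw [wp_block_nil]
  have hval : ∀ x y, e.symm ⟨g'.pred (e x), hp.lt _ (e x).2⟩ = y ↔ g'.pred (e x) = e y := by
    intro x y
    rw [Equiv.symm_apply_eq, Fin.ext_iff]
  refine ⟨by omega, fun x => e.symm ⟨g'.pred (e x), hp.lt _ (e x).2⟩,
    {x | ∃ k < l, g'.queue k = e x}.toFinset, hp.linkage e hadj, ⟨?_, ?_, ?_, ?_⟩, ?_, ?_⟩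
  · simpa using ⟨0, hq.pos, hq.first⟩
  · simpa using fun k hk => hq.ne_sink k hk
  · intro a ha h
    obtain ⟨k, hk, hka⟩ : ∃ k < l, g'.queue k = e a := by simpa using ha
    have := (hsc k hk).1
    rw [hadj', hka] at this
    exact (hadj (e.symm ⟨g'.pred (e a), hp.lt _ (e a).2⟩) F.sink).2 (.inr h) (by simpa using this)
  · intro a ha z hz
    obtain ⟨k, hk, hka⟩ : ∃ k < l, g'.queue k = e a := by simpa using ha
    have := (hsc k hk).2 (e z) (e z).2
    rw [hadj', hka] at this
    have h' := (hadj (e.symm ⟨g'.pred (e a), hp.lt _ (e a).2⟩) z).2 hz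
    simpa using (hq.mark (e z) (e z).2).1 (this (by simpa using h'))
  · simp only
    rw [hr0, FlowNetwork.linkageSize]
    symm
    refine Finset.card_bij (fun x _ => (e x : ℕ)) ?_ ?_ ?_
    · intro x hx
      simp only [Set.mem_toFinset, Set.mem_ofPred_eq, ne_eq, hval] at hx
      simpa using hx
    · intro x _ y _ h
      exact e.injective (Fin.ext h)
    · intro b hb
      obtain ⟨h1, h2⟩ := Finset.mem_filter.1 hb
      refine ⟨e.symm ⟨b, Finset.mem_range.1 h1⟩, ?_, by simp⟩
      simp only [Set.mem_toFinset, Set.mem_ofPred_eq, ne_eq, hval]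
      simpa using h2
  · intro i j
    simp only
    rw [hm i i.2 j j.2]
    rw [FlowNetwork.linkageFlow_eq_ite
      (P := g'.pred j = i ∧ (i : ℕ) ≠ j ∨ (j : ℕ) = e F.sink ∧ ∀ a < n, g'.pred a ≠ i)]
    · push_cast; rfl
    · simp only [hval, Equiv.apply_symm_apply, ne_eq, e.symm.injective.eq_iff, Fin.ext_iff,
        Equiv.symm_apply_eq]
      refine or_congr_right (and_congr_right fun _ => ⟨fun h a ha => ?_, fun h a => h _ (e a).2⟩)
      simpa using h (e.symm ⟨a, ha⟩)

end RAMProgram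

/-- Every network without an edge from the source to the sink has a linkage with a barrier. -/
theorem FlowNetwork.exists_linkage {N : Type u} [Fintype N] (F : FlowNetwork N)
    (hst : F.source ≠ F.sink) (hF : ¬ F.edge F.source F.sink) :
    ∃ p W, F.Linkage p ∧ F.IsBarrier p W := by
  -- Existence is read off from the halting run under an arbitrary numbering.
  obtain ⟨_, _, _, _, p, W, hp, hW, _⟩ := RAMProgram.wp_maxFlow F (Fintype.equivFin N) hst hF
  exact ⟨p, W, hp, hW⟩

/-! ### Tracing paths back from their ends -/

namespace FlowNetwork.Linkage

variable {N : Type u} {F : FlowNetwork N} {p : N → N}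

/-- Cancel `p` on both sides by injectivity until one side is an end; ends are not values of `p`.
This gives disjointness of paths with different ends, and it shows that tracing back from an end
never runs into a cycle. -/
theorem eq_of_iterate_eq (h : F.Linkage p) {x x' : N} (hx : ∀ a, p a ≠ x) (hx' : ∀ a, p a ≠ x')
    {i j : ℕ} (hij : p^[i] x = p^[j] x') (hs : p^[i] x ≠ F.source) : i = j ∧ x = x' := by
  induction i generalizing j with
  | zero =>
    cases j with
    | zero => exact ⟨rfl, hij⟩
    | succ j =>
      rw [Function.iterate_succ_apply'] at hij
      exact absurd hij.symm (hx _)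
  | succ i ih =>
    cases j with
    | zero =>
      rw [Function.iterate_succ_apply'] at hij
      exact absurd hij (hx' _)
    | succ j =>
      rw [Function.iterate_succ_apply', Function.iterate_succ_apply'] at hij
      rw [Function.iterate_succ_apply'] at hs
      have := ih (h.inj _ _ hij hs) fun e => hs (by rw [e, h.source])
      exact ⟨by rw [this.1], this.2⟩

theorem exists_iterate_eq_source [Finite N] (h : F.Linkage p) {x : N} (hx : ∀ a, p a ≠ x) :
    ∃ i, p^[i] x = F.source := by
  by_contra! hs
  exact not_injective_infinite_finite (fun i => p^[i] x) fun i j hij =>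
    (h.eq_of_iterate_eq hx hx hij (hs i)).1

theorem edge_iterate (h : F.Linkage p) {x : N} (hx : ∀ a, p a ≠ x) {i : ℕ}
    (hs : p^[i] x ≠ F.source) : F.edge (p^[i + 1] x) (p^[i] x) := by
  rw [Function.iterate_succ_apply']
  refine (h.step _).resolve_left fun e => ?_
  rw [← Function.iterate_succ_apply' p] at e
  have := (h.eq_of_iterate_eq hx hx e (by rwa [e])).1
  omega

end FlowNetwork.Linkage

/-! ### Structure and size of the network -/

namespace MixedGraph

variable {V : Type u} (G : MixedGraph V)

theorem isUnit_flowNetwork : G.flowNetwork.IsUnit where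
  edgeCap _ _ := rfl
  nodeCap x hs ht := by
    cases x with
    | source => exact absurd rfl hs
    | sink => exact absurd rfl ht
    | left => rfl
    | right => rfl
  source_ne_sink h := by cases h
  not_edge h := by cases h
  not_edge_source x h := by cases h

section Counting

variable [Fintype V]

theorem numDirected_eq_sum : G.numDirected = ∑ v, (G.pa v).ncard := by
  classical
  have h : ∀ v, (G.pa v).ncard =
      (Finset.univ.filter fun q : V × V => G.dir q.1 q.2 ∧ q.2 = v).card := by
    intro v
    rw [← Set.ncard_coe_finset, ← Set.ncard_image_of_injective (f := fun w => (w, v)) (G.pa v)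
      fun a b e => (Prod.ext_iff.1 e).1]
    congr 1
    ext ⟨a, b⟩
    simp only [pa, Set.mem_image, Set.mem_ofPred_eq, Prod.mk.injEq, Finset.coe_filter,
      Finset.mem_univ, true_and]
    constructor
    · rintro ⟨x, hx, rfl, rfl⟩; exact ⟨hx, rfl⟩
    · rintro ⟨hx, rfl⟩; exact ⟨a, hx, rfl, rfl⟩
  have h' : G.numDirected = (Finset.univ.filter fun q : V × V => G.dir q.1 q.2).card := by
    rw [numDirected, ← Set.ncard_coe_finset]
    simp
  rw [h', Finset.card_eq_sum_card_fiberwise (f := Prod.snd) (t := Finset.univ)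
    (fun _ _ => Finset.mem_coe.2 (Finset.mem_univ _))]
  exact Finset.sum_congr rfl fun v _ => by rw [h, Finset.filter_filter]

/-- The map from ordered to unordered pairs has at least two directed edges over each reciprocal
pair. -/
theorem two_mul_numReciprocal_le : 2 * G.numReciprocal ≤ G.numDirected := by
  classical
  have h' : G.numDirected = (Finset.univ.filter fun q : V × V => G.dir q.1 q.2).card := by
    rw [numDirected, ← Set.ncard_coe_finset]
    simp
  set R : Finset (Sym2 V) :=
    Finset.univ.filter fun z => ∃ v w, v ≠ w ∧ G.dir v w ∧ G.dir w v ∧ z = s(v, w) with hR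
  have h : G.numReciprocal = R.card := by
    rw [numReciprocal, ← Set.ncard_coe_finset]
    simp [hR]
  set D := Finset.univ.filter fun q : V × V => G.dir q.1 q.2 with hD
  have h2 : ∀ z ∈ R, 2 ≤ (D.filter fun q => s(q.1, q.2) = z).card := by
    intro z hz
    obtain ⟨v, w, hne, hvw, hwv, rfl⟩ := (Finset.mem_filter.1 hz).2
    rw [← Finset.card_pair (a := (v, w)) (b := (w, v)) (by simp [hne])]
    refine Finset.card_le_card fun q hq => ?_
    rcases Finset.mem_insert.1 hq with rfl | hq
    · simp [hD, hvw]
    · obtain rfl := Finset.mem_singleton.1 hq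
      simp [hD, hwv]
  rw [h, h', mul_comm]
  calc R.card * 2 ≤ ∑ z ∈ R, (D.filter fun q => s(q.1, q.2) = z).card := by
        rw [← smul_eq_mul]
        exact Finset.card_nsmul_le_sum _ _ _ h2
    _ = (D.filter fun q => s(q.1, q.2) ∈ R).card := by
        rw [Finset.card_eq_sum_card_fiberwise (f := fun q : V × V => s(q.1, q.2)) (t := R)]
        · refine Finset.sum_congr rfl fun z hz => ?_
          congr 1
          ext q
          simp only [Finset.mem_filter]
          constructor
          · rintro ⟨h1, h2⟩; exact ⟨⟨h1, h2 ▸ hz⟩, h2⟩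
          · rintro ⟨⟨h1, -⟩, h2⟩; exact ⟨h1, h2⟩
        · intro q hq
          exact (Finset.mem_filter.1 (Finset.mem_coe.1 hq)).2
    _ ≤ D.card := Finset.card_filter_le _ _

theorem card_flowNode_le [Nonempty V] : Fintype.card G.FlowNode ≤ 4 * Fintype.card V ^ 2 := by
  classical
  let φ : G.FlowNode → Bool ⊕ Sym2 V ⊕ V × V := fun x =>
    match x with
    | .source => .inl true
    | .sink => .inl false
    | .left p => .inr (.inl p.1)
    | .right v w => .inr (.inr (v, w))
  have hφ : Function.Injective φ := by
    intro x y h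
    cases x <;> cases y <;> simp_all [φ]
    exact Subtype.ext h
  have h1 := Fintype.card_le_of_injective φ hφ
  have h2 : Fintype.card (Sym2 V) ≤ Fintype.card V * Fintype.card V := by
    rw [← Fintype.card_prod]
    exact Fintype.card_le_of_surjective (fun q : V × V => s(q.1, q.2)) (Sym2.mk_surjective)
  have h3 : 0 < Fintype.card V := Fintype.card_pos
  simp only [Fintype.card_sum, Fintype.card_bool, Fintype.card_prod] at h1
  nlinarith

end Counting

/-! ### From half-trek systems to cuts -/

variable {G}

theorem Trek.IsHalfTrek.head_eq_source {π : G.Trek} (h : π.IsHalfTrek) :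
    π.leftList.head π.left_ne_nil = π.source := by
  obtain ⟨a, ha⟩ := Set.ncard_eq_one.1 h
  have h1 : π.leftList.head π.left_ne_nil ∈ π.left := List.head_mem _
  have h2 : π.source ∈ π.left := List.getLast_mem _
  rw [ha] at h1 h2
  exact h1.trans h2.symm

theorem right_getLast_mem_of_isCut {X K : Finset G.FlowNode} (hc : G.flowNetwork.IsCut X K)
    (v : V) (l : List V) (hl : l ≠ []) (hch : l.IsChain G.dir)
    (hX : FlowNode.right v (l.head hl) ∈ X) (hK : ∀ z ∈ l, FlowNode.right v z ∉ K) :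
    FlowNode.right v (l.getLast hl) ∈ X := by
  induction l with
  | nil => exact absurd rfl hl
  | cons a l ih =>
    cases l with
    | nil => exact hX
    | cons b l =>
      rw [List.getLast_cons (List.cons_ne_nil b l)]
      obtain ⟨hab, hch⟩ := List.isChain_cons_cons.1 hch
      refine ih (List.cons_ne_nil b l) hch ?_ fun z hz => hK z (List.mem_cons_of_mem _ hz)
      exact (hc.closed _ hX _ (.right_right v a b hab)).resolve_right (hK b (by simp))

/-- The half-trek traces the walk s → L{v, source} → R_v(…) → … → R_v(target) → t. If it avoided
`K`, it would stay in `X` and reach the sink. Repeated nodes do no harm here. -/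
theorem Trek.exists_mem_of_isCut {X K : Finset G.FlowNode} (hc : G.flowNetwork.IsCut X K)
    {π : G.Trek} (hπ : π.IsHalfTrek) {v : V} (ht : π.target ∈ G.pa v)
    (hs : π.source ∉ ({v} ∪ G.sib v : Set V)) :
    ∃ κ ∈ K, (∃ q : G.NonSiblingPair, q.1 = s(v, π.source) ∧ κ = .left q) ∨
      ∃ z ∈ π.right, κ = .right v z := by
  by_contra! hK
  have hne : v ≠ π.source := fun e => hs (.inl e.symm)
  have hb : ¬ G.bidir v π.source := fun e => hs (.inr (G.bidir_symm _ _ e))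
  let q : G.NonSiblingPair := ⟨s(v, π.source), v, π.source, hne, hb, rfl⟩
  have h1 : FlowNode.left q ∈ X :=
    (hc.closed _ hc.source_mem _ (FlowEdge.source_left q)).resolve_right
      fun h => (hK _ h).1 q rfl rfl
  have hright : ∀ z ∈ π.rightList, FlowNode.right v z ∉ K := fun z hz h => (hK _ h).2 z hz rfl
  have h2 : FlowNode.right v (π.rightList.head π.right_ne_nil) ∈ X := by
    refine (hc.closed _ h1 _ ?_).resolve_right (hright _ (List.head_mem _))
    have hj := π.join
    rw [hπ.head_eq_source] at hj
    rcases hj with hj | hj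
    · exact FlowEdge.left_right q v _ (by rw [← hj])
    · exact FlowEdge.left_right_sib q v π.source _ rfl hj
  have h3 := right_getLast_mem_of_isCut hc v _ π.right_ne_nil π.right_chain h2 hright
  exact (hc.closed _ h3 _ (FlowEdge.right_sink v _ ht)).elim hc.sink_notMem hc.sink_notMem'

theorem numDirected_le_card_of_isCut [Fintype V] {X K : Finset G.FlowNode}
    (hc : G.flowNetwork.IsCut X K) {Y : V → Set V} (hY : ∀ v, G.HalfTrekCriterion v (Y v))
    (hY' : ∀ v w, v ∈ Y w → w ∉ Y v) : G.numDirected ≤ K.card := by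
  choose hcard hdisj T hT hhalf hsided using hY
  have hπ : ∀ q : V × V, ∃ π : G.Trek, ∃ κ, G.dir q.1 q.2 → (π ∈ T q.2 ∧ π.target = q.1 ∧ κ ∈ K ∧
      ((∃ z : G.NonSiblingPair, z.1 = s(q.2, π.source) ∧ κ = .left z) ∨
      ∃ z ∈ π.right, κ = .right q.2 z)) := by
    rintro ⟨w, v⟩
    by_cases hd : G.dir w v
    · obtain ⟨π, hπ, hπw⟩ := (hT v).2.surjOn (show w ∈ G.pa v from hd)
      obtain ⟨κ, hκ, h⟩ := Trek.exists_mem_of_isCut hc (hhalf v π hπ) (v := v)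
        (by rw [hπw]; exact hd) fun hs => by
          have : π.source ∈ Y v ∩ ({v} ∪ G.sib v) := ⟨(hT v).1.mapsTo hπ, hs⟩
          rw [hdisj] at this
          exact this
      exact ⟨π, κ, fun _ => ⟨hπ, hπw, hκ, h⟩⟩
    · obtain ⟨z⟩ : Nonempty V := ⟨w⟩
      -- An arbitrary value where there is no edge, needed only to make the choice total.
      exact ⟨⟨[z], [z], by simp, by simp, by simp, by simp, .inl rfl⟩, .source,
        fun h => absurd h hd⟩
  choose π κ hπ using hπ
  rw [numDirected, ← Set.ncard_coe_finset]
  refine Set.ncard_le_ncard_of_injOn κ (fun q hq => (hπ q hq).2.2.1) ?_ K.finite_toSet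
  rintro ⟨w, v⟩ hq ⟨w', v'⟩ hq' he
  obtain ⟨hT1, ht1, -, h1⟩ := hπ _ hq
  obtain ⟨hT2, ht2, -, h2⟩ := hπ _ hq'
  rw [← he] at h2
  simp only at hT1 hT2 ht1 ht2 h1 h2
  rcases h1 with ⟨z, hz, hκ⟩ | ⟨z, hz, hκ⟩ <;> rcases h2 with ⟨z', hz', hκ'⟩ | ⟨z', hz', hκ'⟩ <;>
    rw [hκ] at hκ'
  · obtain rfl : z = z' := by injection hκ'
    rw [hz, Sym2.eq_iff] at hz'
    rcases hz' with ⟨rfl, hss⟩ | ⟨hv, hv'⟩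
    · have := (hT v).1.injOn hT1 hT2 hss
      rw [← ht1, ← ht2, this]
    -- The pair is met from its two sides, so each of `v`, `v'` is a source for the other.
    · have h3 := (hT v).1.mapsTo hT1
      have h4 := (hT v').1.mapsTo hT2
      rw [hv'] at h3
      rw [← hv] at h4
      exact absurd h3 (hY' _ _ h4)
  · cases hκ'
  · cases hκ'
  · obtain ⟨rfl, rfl⟩ : v = v' ∧ z = z' := by injection hκ' with h1 h2; exact ⟨h1, h2⟩
    by_cases hne : π (w, v) = π (w', v)
    · rw [← ht1, ← ht2, hne]
    · exact absurd hz' (Set.disjoint_left.1 (hsided v _ hT1 _ hT2 hne).2 hz)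

/-! ### From linkages to half-trek systems -/

/-- Going back from R_v(w), the path remains in the copy R_v until it enters some L{v, y}; the edge
used there is `left_right` or `left_right_sib`, the two ways in which a half-trek can begin at y. -/
theorem exists_halfTrek_of_linkage [Finite V] {p : G.FlowNode → G.FlowNode}
    (h : G.flowNetwork.Linkage p) {v w : V} (hx : ∀ a, p a ≠ .right v w) :
    ∃ π : G.Trek, π.IsHalfTrek ∧ π.target = w ∧
      (∃ q : G.NonSiblingPair, q.1 = s(v, π.source) ∧ ∃ i, p^[i] (.right v w) = .left q) ∧
      ∀ z ∈ π.right, ∃ i, p^[i] (.right v w) = .right v z := by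
  obtain ⟨n, hn⟩ := h.exists_iterate_eq_source hx
  -- After `i` steps back, either the half-trek is complete or the visited part is a directed walk
  -- `l` to `w`. At the source only the former is possible.
  have key : ∀ i, (∃ π : G.Trek, π.IsHalfTrek ∧ π.target = w ∧
      (∃ q : G.NonSiblingPair, q.1 = s(v, π.source) ∧ ∃ i, p^[i] (.right v w) = .left q) ∧
      ∀ z ∈ π.right, ∃ i, p^[i] (.right v w) = .right v z) ∨
      ∃ (l : List V) (hl : l ≠ []), l.IsChain G.dir ∧ l.getLast hl = w ∧
        p^[i] (.right v w) = .right v (l.head hl) ∧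
        ∀ z ∈ l, ∃ i, p^[i] (.right v w) = .right v z := by
    intro i
    induction i with
    | zero =>
      refine .inr ⟨[w], by simp, by simp, rfl, rfl, fun z hz => ⟨0, ?_⟩⟩
      rw [List.mem_singleton.1 hz]
      rfl
    | succ i ih =>
      rcases ih with ih | ⟨l, hl, hch, hlast, hi, hmem⟩
      · exact .inl ih
      · have he : G.FlowEdge (p^[i + 1] (.right v w)) (p^[i] (.right v w)) :=
          h.edge_iterate hx (by rw [hi]; rintro ⟨⟩)
        have trek : ∀ (q : G.NonSiblingPair) (y : V), p^[i + 1] (.right v w) = .left q →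
            q.1 = s(v, y) → (y = l.head hl ∨ G.bidir y (l.head hl)) →
            ∃ π : G.Trek, π.IsHalfTrek ∧ π.target = w ∧
              (∃ q : G.NonSiblingPair, q.1 = s(v, π.source) ∧
                ∃ i, p^[i] (.right v w) = .left q) ∧
              ∀ z ∈ π.right, ∃ i, p^[i] (.right v w) = .right v z := by
          intro q y hqi hq hy
          refine ⟨⟨[y], l, by simp, hl, by simp, hch, hy⟩, ?_, hlast, ⟨q, hq, _, hqi⟩, hmem⟩
          have : ({x | x ∈ [y]} : Set V) = {y} := by ext; simp
          exact Set.ncard_eq_one.2 ⟨y, this⟩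
        generalize hz : p^[i + 1] (.right v w) = z at he trek
        rw [hi] at he
        cases he with
        | left_right q v u hq => exact .inl (trek q _ rfl hq (.inl rfl))
        | left_right_sib q v u x hq hb => exact .inl (trek q u rfl hq (.inr hb))
        | right_right v u x hd =>
          refine .inr ⟨u :: l, List.cons_ne_nil _ _, ?_, ?_, ?_, ?_⟩
          · cases l with
            | nil => exact absurd rfl hl
            | cons b l => exact List.isChain_cons_cons.2 ⟨hd, hch⟩
          · rw [List.getLast_cons hl, hlast]
          · rfl
          · intro z hz'
            rcases List.mem_cons.1 hz' with rfl | hz'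
            · exact ⟨_, hz⟩
            · exact hmem z hz'
  rcases key n with h' | ⟨l, hl, -, -, hi, -⟩
  · exact h'
  · rw [hn] at hi
    cases hi

theorem exists_family_of_linkage [Fintype V] {p : G.FlowNode → G.FlowNode}
    (h : G.flowNetwork.Linkage p) (hsize : G.numDirected ≤ G.flowNetwork.linkageSize p) :
    ∃ Y : V → Set V, (∀ v, G.HalfTrekCriterion v (Y v)) ∧ ∀ v w, v ∈ Y w → w ∉ Y v := by
  classical
  -- Ends of paths are nodes R_v(w) with w ∈ pa(v), of which there are |D|. With at least |D| paths,
  -- all of them are ends.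
  have hmissing : ∀ v, ∀ w ∈ G.pa v, ∀ a, p a ≠ .right v w := by
    let φ : V × V → G.FlowNode := fun q => .right q.2 q.1
    have hφ : Function.Injective φ := by
      rintro ⟨a, b⟩ ⟨c, d⟩ e
      injection e with e1 e2
      exact Prod.ext e2 e1
    have hsub : {x | ∀ a, p a ≠ x} ⊆ φ '' {q : V × V | G.dir q.1 q.2} := by
      intro x hx
      have he : G.FlowEdge x .sink := h.last x hx
      cases he with
      | right_sink v w hw => exact ⟨(w, v), hw, rfl⟩
    have heq := Set.eq_of_subset_of_ncard_le hsub (by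
      rw [Set.ncard_image_of_injective _ hφ, h.card_missing]
      exact hsize)
    intro v w hw
    have : FlowNode.right v w ∈ {x | ∀ a, p a ≠ x} := heq ▸ ⟨(w, v), hw, rfl⟩
    exact this
  have hπ : ∀ v w, ∃ π : G.Trek, w ∈ G.pa v → (π.IsHalfTrek ∧ π.target = w ∧
      (∃ q : G.NonSiblingPair, q.1 = s(v, π.source) ∧ ∃ i, p^[i] (.right v w) = .left q) ∧
      ∀ z ∈ π.right, ∃ i, p^[i] (.right v w) = .right v z) := by
    intro v w
    by_cases hw : w ∈ G.pa v
    · obtain ⟨π, hπ⟩ := exists_halfTrek_of_linkage h (hmissing v w hw)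
      exact ⟨π, fun _ => hπ⟩
    · exact ⟨⟨[w], [w], by simp, by simp, by simp, by simp, .inl rfl⟩, fun h => absurd h hw⟩
  choose π hπ using hπ
  have hsource : ∀ v, ∀ w ∈ G.pa v, ∀ v', ∀ w' ∈ G.pa v',
      s(v, (π v w).source) = s(v', (π v' w').source) → v = v' ∧ w = w' := by
    intro v w hw v' w' hw' e
    obtain ⟨-, -, ⟨q, hq, i, hi⟩, -⟩ := hπ v w hw
    obtain ⟨-, -, ⟨q', hq', i', hi'⟩, -⟩ := hπ v' w' hw'
    obtain rfl : q = q' := Subtype.ext (by rw [hq, hq', e])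
    have := (h.eq_of_iterate_eq (hmissing v w hw) (hmissing v' w' hw') (hi.trans hi'.symm)
      (by rw [hi]; rintro ⟨⟩)).2
    injection this with h1 h2
    exact ⟨h1, h2⟩
  have hns : ∀ v, ∀ w ∈ G.pa v, (π v w).source ∉ ({v} ∪ G.sib v : Set V) := by
    intro v w hw
    obtain ⟨-, -, ⟨q, hq, -⟩, -⟩ := hπ v w hw
    obtain ⟨a, b, hne, hb, hab⟩ := q.2
    rw [hab, Sym2.eq_iff] at hq
    rintro (e | e)
    · rcases hq with ⟨rfl, rfl⟩ | ⟨rfl, rfl⟩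
      · exact hne e.symm
      · exact hne e
    · rcases hq with ⟨rfl, rfl⟩ | ⟨rfl, rfl⟩
      · exact hb (G.bidir_symm _ _ e)
      · exact hb e
  refine ⟨fun v => (fun w => (π v w).source) '' G.pa v, fun v => ⟨?_, ?_, π v '' G.pa v, ⟨?_, ?_⟩,
    ?_, ?_⟩, ?_⟩
  · exact Set.InjOn.ncard_image fun w hw w' hw' e =>
      (hsource v w hw v w' hw' (by rw [show (π v w).source = _ from e])).2
  · rw [Set.eq_empty_iff_forall_notMem]
    rintro _ ⟨⟨w, hw, rfl⟩, hy⟩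
    exact hns v w hw hy
  · refine ⟨?_, ?_, ?_⟩
    · rintro _ ⟨w, hw, rfl⟩
      exact ⟨w, hw, rfl⟩
    · rintro _ ⟨w, hw, rfl⟩ _ ⟨w', hw', rfl⟩ e
      rw [(hsource v w hw v w' hw' (by rw [e])).2]
    · rintro _ ⟨w, hw, rfl⟩
      exact ⟨_, ⟨w, hw, rfl⟩, rfl⟩
  · refine ⟨?_, ?_, ?_⟩
    · rintro _ ⟨w, hw, rfl⟩
      rw [(hπ v w hw).2.1]
      exact hw
    · rintro _ ⟨w, hw, rfl⟩ _ ⟨w', hw', rfl⟩ e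
      rw [(hπ v w hw).2.1, (hπ v w' hw').2.1] at e
      rw [e]
    · intro w hw
      exact ⟨_, ⟨w, hw, rfl⟩, (hπ v w hw).2.1⟩
  · rintro _ ⟨w, hw, rfl⟩
    exact (hπ v w hw).1
  · rintro _ ⟨w, hw, rfl⟩ _ ⟨w', hw', rfl⟩ hne
    have hww : w ≠ w' := fun e => hne (by rw [e])
    constructor
    · obtain ⟨a, ha⟩ := Set.ncard_eq_one.1 (hπ v w hw).1
      obtain ⟨b, hb⟩ := Set.ncard_eq_one.1 (hπ v w' hw').1
      have h1 : (π v w).source ∈ (π v w).left := List.getLast_mem _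
      have h2 : (π v w').source ∈ (π v w').left := List.getLast_mem _
      rw [ha] at h1
      rw [hb] at h2
      rw [ha, hb, Set.disjoint_singleton, ← Set.mem_singleton_iff.1 h1,
        ← Set.mem_singleton_iff.1 h2]
      exact fun e => hww (hsource v w hw v w' hw' (by rw [e])).2
    · rw [Set.disjoint_left]
      intro z hz hz'
      obtain ⟨i, hi⟩ := (hπ v w hw).2.2.2 z hz
      obtain ⟨j, hj⟩ := (hπ v w' hw').2.2.2 z hz'
      have := (h.eq_of_iterate_eq (hmissing v w hw) (hmissing v w' hw') (hi.trans hj.symm)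
        (by rw [hi]; rintro ⟨⟩)).2
      injection this with h1 h2
      exact hww h2
  · rintro v v' ⟨w, hw, hv⟩ ⟨w', hw', hv'⟩
    simp only at hv hv'
    -- Mutual membership would make two paths use the same node L{v, v'}, which forces `v = v'`; but
    -- a source for `v` differs from `v`.
    have := (hsource v' w hw v w' hw' (by rw [hv, hv', Sym2.eq_swap])).1
    subst this
    exact hns _ w hw (.inl hv)

/-! ### The equivalence and the running time -/

theorem hTCInfiniteToOne_iff [Fintype V] : G.HTCInfiniteToOne ↔
    ∃ f : G.FlowNode → G.FlowNode → ℝ≥0, G.flowNetwork.IsMaxFlow f ∧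
      G.flowNetwork.size f < (G.numDirected : ℝ≥0) := by
  have hU := G.isUnit_flowNetwork
  obtain ⟨p, W, hp, hW⟩ := G.flowNetwork.exists_linkage hU.source_ne_sink hU.not_edge
  constructor
  · intro hG
    refine ⟨_, hp.isMaxFlow hU hW, ?_⟩
    by_contra! hle
    rw [hp.size_linkageFlow, Nat.cast_le] at hle
    obtain ⟨Y, hY, hY'⟩ := exists_family_of_linkage hp hle
    rcases hG Y with ⟨v, hv⟩ | ⟨v, w, hv, hw⟩
    · exact hv (hY v)
    · exact hY' v w hv hw
  · rintro ⟨f, hf, hlt⟩ Y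
    by_contra! hY
    obtain ⟨X, K, hc, hK⟩ := hp.exists_isCut hW
    have h1 := numDirected_le_card_of_isCut hc hY.1 hY.2
    have h2 := hf.2 _ (hp.isFlow hU)
    rw [hp.size_linkageFlow, ← hK] at h2
    exact (h2.trans_lt hlt).not_ge (by exact_mod_cast h1)

end MixedGraph

theorem theorem8 :
    (∀ (V : Type u) [Fintype V] (G : MixedGraph V),
      (G.HTCInfiniteToOne ↔
        ∃ f : G.FlowNode → G.FlowNode → ℝ≥0, G.flowNetwork.IsMaxFlow f ∧
          G.flowNetwork.size f < (G.numDirected : ℝ≥0)) ∧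
      G.numDirected = ∑ v, (G.pa v).ncard ∧
      2 * G.numReciprocal ≤ G.numDirected) ∧
    ∃ (P : RAMProgram) (C : ℕ),
      ∀ (V : Type u) [Fintype V] [Nonempty V] (G : MixedGraph V)
        (n : ℕ) (e : G.FlowNode ≃ Fin n),
        ∃ (σ : RAMState) (k : ℕ),
          RAMExec P (G.flowNetwork.input e) σ k ∧
          G.flowNetwork.IsOutput e σ ∧
          k ≤ C * (Fintype.card V ^ 3 * (Fintype.card V + G.numReciprocal) ^ 3) := by
  refine ⟨fun V _ G => ⟨G.hTCInfiniteToOne_iff, G.numDirected_eq_sum, G.two_mul_numReciprocal_le⟩,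
    -- The program takes at most 400 n³ steps, and n ≤ 4|V|².
    RAMProgram.maxFlow, 400 * 4 ^ 3, fun V _ _ G n e => ?_⟩
  have hU := G.isUnit_flowNetwork
  obtain ⟨σ, k, hexec, hk, p, W, hp, hW, h0, hout⟩ :=
    RAMProgram.wp_maxFlow G.flowNetwork e hU.source_ne_sink hU.not_edge
  refine ⟨σ, k, hexec, ⟨_, hp.isMaxFlow hU hW, ?_, hout⟩, hk.trans ?_⟩
  · rw [hp.size_linkageFlow, h0]
  · have hn : n ≤ 4 * Fintype.card V ^ 2 := by
      have := Fintype.card_congr e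
      rw [Fintype.card_fin] at this
      rw [← this]
      exact G.card_flowNode_le
    calc 400 * (n * n * n) = 400 * n ^ 3 := by ring
      _ ≤ 400 * (4 * Fintype.card V ^ 2) ^ 3 := by gcongr
      _ = 400 * 4 ^ 3 * (Fintype.card V ^ 3 * Fintype.card V ^ 3) := by ring
      _ ≤ _ := by gcongr; exact Nat.le_add_right _ _
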